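/- All manifolds, maps, forms and functions are smooth ($C^\infty$). Let $M$ be a $3$-manifold with a contact distribution $\mathcal D\subset TM$ (locally the kernel of a one-form $\alpha$ with $\alpha\wedge d\alpha\neq 0$ everywhere), let $P$ be a $5$-manifold, let $\rho:P\to M$ be a surjective submersion (for instance a fibration with two-dimensional fibres), and let $L\subset TP$ be a line field with $L\cap\ker\rho_*=0$. For a Pfaffian system $S\subset T^*P$, its first derived system $S'$ is, at each point $p$, the set of values $\theta_p$ of local sections $\theta$ of $S$ with $d\theta\equiv 0 \bmod S$ at $p$; its retracting space $\mathcal C(S)$ is the annihilator of the vectors $v\in S^\perp$ such that $v\lrcorner\, d\theta\in S$ for all local sections $\theta$ of $S$. Let $\mathcal I\subset T^*P$ be the annihilator of $L\oplus\ker\rho_*$ and $\mathcal J=\mathcal C(\mathcal I)\cap L^\perp$. Suppose that $(P,L,\rho)$ is a contact path geometry on $M$, i.e. (i) $\rho_*(v)\in\mathcal D$ for all $v\in L$; (ii) $\mathcal I'$ is one-dimensional at each point of $P$; (iii) $\mathcal J'=\mathcal I$ at each point of $P$. A coframe $(\sigma,\theta_0,\theta_1,\theta_2,\theta_3)$ on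 an open set $U\subset P$ is called $0$-adapted if on $U$: (1) $\rho_*(v)\in\mathcal D$ if and only if $\theta_0(v)=0$; (2) $\mathcal I=\mathrm{span}\{\theta_0,\theta_1\}$; (3) $\mathcal J=\mathrm{span}\{\theta_0,\theta_1,\theta_2\}$; (4) $L^\perp=\mathrm{span}\{\theta_0,\theta_1,\theta_2,\theta_3\}$; and $d\theta_i\equiv\theta_{i+1}\wedge\sigma \bmod \theta_0,\dots,\theta_i$ for $0\le i\le 2$. Corollary. Every point $q\in P$ has an open neighbourhood $U$ with coordinates $x,y_0,y_1,y_2,y_3$ and a smooth function $F=F(x,y_0,y_1,y_2,y_3)$ on $U$ such that $$\sigma=-dx,\quad \theta_0=dy_0-y_1\,dx,\quad \theta_1=dy_1-y_2\,dx,\quad \theta_2=dy_2-y_3\,dx,\quad \theta_3=dy_3-F\,dx$$ is a $0$-adapted coframe on $U$. Consequently the paths of $P$ (immersed curves, parametrised by open intervals, everywhere tangent to $L$) are locally equivalent to the solutions of the fourth-order ODE $y''''=F(x,y,y',y'',y''')$: for every solution $y$ on an open interval whose jet $(x,y(x),y'(x),y''(x),y'''(x))$ stays in the coordinate domain, the curve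 in $U$ with coordinates $(x,y_0,\dots,y_3)=(x,y(x),y'(x),y''(x),y'''(x))$ is a path; and conversely, along every path in $U$ the coordinate $x$ is injective, and the path, reparametrised by $x$, is the curve obtained in this way from a solution $y$ on the open interval of values of $x$. -/

import Mathlib

open scoped Manifold ContDiff Topology

noncomputable section

namespace ContactPath

/-! ### One-forms and two-forms on a smooth manifold of dimension `n` -/

section Forms

variable {n : ℕ} {X : Type*} [TopologicalSpace X] [ChartedSpace (EuclideanSpace ℝ (Fin n)) X]

/-- A (not necessarily smooth) differential one-form on the `n`-manifold `X`. -/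
abbrev OneForm (n : ℕ) (X : Type*) [TopologicalSpace X]
    [ChartedSpace (EuclideanSpace ℝ (Fin n)) X] : Type _ :=
  ∀ p : X, TangentSpace (𝓡 n) p →L[ℝ] ℝ

/-- The one-form `θ` is smooth on `U`: it is a smooth section of the cotangent bundle over `U`. -/
def OneForm.SmoothOn [IsManifold (𝓡 n) ∞ X] (θ : OneForm n X) (U : Set X) : Prop :=
  ContMDiffOn (𝓡 n) ((𝓡 n).prod 𝓘(ℝ, EuclideanSpace ℝ (Fin n) →L[ℝ] ℝ)) ∞
    (fun p => Bundle.TotalSpace.mk' (EuclideanSpace ℝ (Fin n) →L[ℝ] ℝ)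
      (E := fun p : X => TangentSpace (𝓡 n) p →L[ℝ] Bundle.Trivial X ℝ p) p (θ p)) U

/-- The differential of a real function, as a one-form. -/
def dFun (n : ℕ) {X : Type*} [TopologicalSpace X]
    [ChartedSpace (EuclideanSpace ℝ (Fin n)) X] (f : X → ℝ) : OneForm n X :=
  fun p => mvfderiv (𝓡 n) f p

/-- The wedge product of two covectors, as a bilinear function:
`(α ∧ β)(v, w) = α(v) β(w) - α(w) β(v)`. -/
def wedge {V : Type*} [AddCommGroup V] [Module ℝ V] [TopologicalSpace V]
    (α β : V →L[ℝ] ℝ) : V → V → ℝ :=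
  fun v w => α v * β w - α w * β v

/-- The exterior derivative of a one-form at `p`, computed in the preferred chart at `p`: pull the
form back along the inverse of the chart, take the exterior derivative in the model space, and
evaluate it on the images of the tangent vectors. It has the normalisation
`dθ(v, w) = v(θ(w)) - w(θ(v)) - θ([v, w])`. -/
def OneForm.d (θ : OneForm n X) (p : X) (v w : TangentSpace (𝓡 n) p) : ℝ :=
  extDeriv (𝕜 := ℝ) (E := EuclideanSpace ℝ (Fin n)) (F := ℝ)
    (fun z => ContinuousAlternatingMap.ofSubsingleton ℝ (EuclideanSpace ℝ (Fin n)) ℝ (0 : Fin 1)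
      ((θ ((extChartAt (𝓡 n) p).symm z)).comp
        (mfderiv 𝓘(ℝ, EuclideanSpace ℝ (Fin n)) (𝓡 n) (extChartAt (𝓡 n) p).symm z)))
    (extChartAt (𝓡 n) p p)
    ![mfderiv (𝓡 n) 𝓘(ℝ, EuclideanSpace ℝ (Fin n)) (extChartAt (𝓡 n) p) p v,
      mfderiv (𝓡 n) 𝓘(ℝ, EuclideanSpace ℝ (Fin n)) (extChartAt (𝓡 n) p) p w]

/-- `Ω ≡ Ω' mod W`: the difference of the two-forms `Ω`, `Ω'` on `V` lies in the ideal generated by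
the space `W` of covectors, i.e. it is a sum of products `α ∧ β` with `α ∈ W`. -/
def CongrMod {V : Type*} [AddCommGroup V] [Module ℝ V] [TopologicalSpace V]
    (W : Submodule ℝ (V →L[ℝ] ℝ)) (Ω Ω' : V → V → ℝ) : Prop :=
  Ω - Ω' ∈ Submodule.span ℝ {η : V → V → ℝ | ∃ α ∈ W, ∃ β : V →L[ℝ] ℝ, η = wedge α β}

/-- The covectors vanishing on the subspace `D`. -/
def annihilator {V : Type*} [AddCommGroup V] [Module ℝ V] [TopologicalSpace V]
    (D : Submodule ℝ V) : Submodule ℝ (V →L[ℝ] ℝ) where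
  carrier := {φ | ∀ v ∈ D, φ v = 0}
  add_mem' := fun {a b} ha hb v hv => by simp [ha v hv, hb v hv]
  zero_mem' := fun v _ => by simp
  smul_mem' := fun c φ hφ v hv => by simp [hφ v hv]

end Forms

/-! ### Distributions and Pfaffian systems -/

section Systems

variable {n : ℕ} {X : Type*} [TopologicalSpace X] [ChartedSpace (EuclideanSpace ℝ (Fin n)) X]

/-- A field of subspaces of the tangent spaces. -/
abbrev TangentSubspaces (n : ℕ) (X : Type*) [TopologicalSpace X]
    [ChartedSpace (EuclideanSpace ℝ (Fin n)) X] : Type _ :=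
  ∀ p : X, Submodule ℝ (TangentSpace (𝓡 n) p)

/-- A field of subspaces of the cotangent spaces (a Pfaffian system, given pointwise). -/
abbrev PfaffianSystem (n : ℕ) (X : Type*) [TopologicalSpace X]
    [ChartedSpace (EuclideanSpace ℝ (Fin n)) X] : Type _ :=
  ∀ p : X, Submodule ℝ (TangentSpace (𝓡 n) p →L[ℝ] ℝ)

variable [IsManifold (𝓡 n) ∞ X]

/-- `L` is a smooth line field: near every point it is spanned by a nowhere vanishing smooth
vector field. -/
def IsLineField (L : TangentSubspaces n X) : Prop :=
  ∀ p : X, ∃ U : Set X, IsOpen U ∧ p ∈ U ∧ ∃ v : ∀ y : X, TangentSpace (𝓡 n) y,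
    ContMDiffOn (𝓡 n) (𝓡 n).tangent ∞ (fun y => (⟨y, v y⟩ : TangentBundle (𝓡 n) X)) U ∧
    ∀ y ∈ U, v y ≠ 0 ∧ L y = Submodule.span ℝ {v y}

/-- `θ` is a smooth section of the Pfaffian system `S`, defined on a neighbourhood of `p`. -/
def IsLocalSection (S : PfaffianSystem n X) (p : X) (θ : OneForm n X) : Prop :=
  ∃ U : Set X, IsOpen U ∧ p ∈ U ∧ θ.SmoothOn U ∧ ∀ y ∈ U, θ y ∈ S y

/-- The first derived system `S'` of `S`: at `p` it consists of the values `θ p` of the local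
sections `θ` of `S` with `dθ ≡ 0 mod S` at `p`. (These values form a subspace, so that taking the
span only serves to bundle them.) -/
def derivedSystem (S : PfaffianSystem n X) : PfaffianSystem n X := fun p =>
  Submodule.span ℝ {φ | ∃ θ : OneForm n X, IsLocalSection S p θ ∧ CongrMod (S p) (θ.d p) 0 ∧
    θ p = φ}

/-- The vector `v` at `p` is a Cauchy characteristic vector of `S`: it is annihilated by `S`, and
its contraction with `dθ` lies in `S` for every local section `θ` of `S`. Equivalently, contraction
with `v` preserves the differential ideal generated by `S`. -/
def IsCauchyCharacteristic (S : PfaffianSystem n X) (p : X) (v : TangentSpace (𝓡 n) p) : Prop :=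
  (∀ φ ∈ S p, φ v = 0) ∧
    ∀ θ : OneForm n X, IsLocalSection S p θ → ∃ φ ∈ S p, ∀ w, θ.d p v w = φ w

/-- The retracting space (Cartan system) of `S`: the covectors that vanish on all Cauchy
characteristic vectors. -/
def retractingSpace (S : PfaffianSystem n X) : PfaffianSystem n X := fun p =>
  annihilator (Submodule.span ℝ {v | IsCauchyCharacteristic S p v})

end Systems

/-- `D` is a contact distribution on the 3-manifold `M`: near every point it is the kernel of a
smooth one-form `α` with `α ∧ dα` nowhere zero. -/
def IsContactDistribution {M : Type*} [TopologicalSpace M]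
    [ChartedSpace (EuclideanSpace ℝ (Fin 3)) M] [IsManifold (𝓡 3) ∞ M]
    (D : TangentSubspaces 3 M) : Prop :=
  ∀ x : M, ∃ V : Set M, IsOpen V ∧ x ∈ V ∧ ∃ α : OneForm 3 M, α.SmoothOn V ∧
    ∀ y ∈ V, (∀ v, v ∈ D y ↔ α y v = 0) ∧
      ∃ u v w, α y u * α.d y v w + α y v * α.d y w u + α y w * α.d y u v ≠ 0

section PathGeometry

variable {P M : Type*} [TopologicalSpace P] [ChartedSpace (EuclideanSpace ℝ (Fin 5)) P]
  [TopologicalSpace M] [ChartedSpace (EuclideanSpace ℝ (Fin 3)) M]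

/-- The tangent spaces of the fibres of `ρ`. -/
def vertical (ρ : P → M) : TangentSubspaces 5 P := fun p =>
  LinearMap.ker (mfderiv (𝓡 5) (𝓡 3) ρ p).toLinearMap

/-- The Pfaffian system `I` on `P` which annihilates `L` and the fibres of `ρ`. -/
def systemI (ρ : P → M) (L : TangentSubspaces 5 P) : PfaffianSystem 5 P := fun p =>
  annihilator (L p ⊔ vertical ρ p)

variable [IsManifold (𝓡 5) ∞ P]

/-- The intersection `J` of the retracting space of `I` with the annihilator of `L`. -/
def systemJ (ρ : P → M) (L : TangentSubspaces 5 P) : PfaffianSystem 5 P := fun p =>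
  retractingSpace (systemI ρ L) p ⊓ annihilator (L p)

/-- `(P, L, ρ)` is a contact path geometry on the contact manifold `(M, D)`. -/
structure IsContactPathGeometry [IsManifold (𝓡 3) ∞ M] (D : TangentSubspaces 3 M) (ρ : P → M)
    (L : TangentSubspaces 5 P) : Prop where
  contact : IsContactDistribution D
  smooth : ContMDiff (𝓡 5) (𝓡 3) ∞ ρ
  surjective : Function.Surjective ρ
  submersion : ∀ p, Function.Surjective (mfderiv (𝓡 5) (𝓡 3) ρ p)
  lineField : IsLineField L
  transverse : ∀ p, L p ⊓ vertical ρ p = ⊥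
  tangent_contact : ∀ p, ∀ v ∈ L p, mfderiv (𝓡 5) (𝓡 3) ρ p v ∈ D (ρ p)
  derived_I : ∀ p, Module.finrank ℝ (derivedSystem (systemI ρ L) p) = 1
  derived_J : ∀ p, derivedSystem (systemJ ρ L) p = systemI ρ L p

/-- `(σ, θ 0, θ 1, θ 2, θ 3)` is a 0-adapted coframe on the open set `U`. -/
structure IsZeroAdapted (D : TangentSubspaces 3 M) (ρ : P → M)
    (L : TangentSubspaces 5 P) (U : Set P) (σ : OneForm 5 P) (θ : Fin 4 → OneForm 5 P) :
    Prop where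
  smooth_sigma : σ.SmoothOn U
  smooth_theta : ∀ i, (θ i).SmoothOn U
  coframe : ∀ p ∈ U, LinearIndependent ℝ ![σ p, θ 0 p, θ 1 p, θ 2 p, θ 3 p]
  contact : ∀ p ∈ U, ∀ v, mfderiv (𝓡 5) (𝓡 3) ρ p v ∈ D (ρ p) ↔ θ 0 p v = 0
  span_I : ∀ p ∈ U, systemI ρ L p = Submodule.span ℝ {θ 0 p, θ 1 p}
  span_J : ∀ p ∈ U, systemJ ρ L p = Submodule.span ℝ {θ 0 p, θ 1 p, θ 2 p}
  span_L : ∀ p ∈ U, annihilator (L p) = Submodule.span ℝ {θ 0 p, θ 1 p, θ 2 p, θ 3 p}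
  structure_zero : ∀ p ∈ U,
    CongrMod (Submodule.span ℝ {θ 0 p}) ((θ 0).d p) (wedge (θ 1 p) (σ p))
  structure_one : ∀ p ∈ U,
    CongrMod (Submodule.span ℝ {θ 0 p, θ 1 p}) ((θ 1).d p) (wedge (θ 2 p) (σ p))
  structure_two : ∀ p ∈ U,
    CongrMod (Submodule.span ℝ {θ 0 p, θ 1 p, θ 2 p}) ((θ 2).d p) (wedge (θ 3 p) (σ p))

/-- `γ` is a path over the open interval `s`: a smooth immersed curve in `P` that is everywhere
tangent to the line field `L`. -/
def IsPathOn (L : TangentSubspaces 5 P) (γ : ℝ → P) (s : Set ℝ) : Prop :=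
  IsOpen s ∧ s.OrdConnected ∧ ContMDiffOn 𝓘(ℝ, ℝ) (𝓡 5) ∞ γ s ∧
    ∀ t ∈ s, mfderiv 𝓘(ℝ, ℝ) (𝓡 5) γ t (1 : ℝ) ≠ 0 ∧
      mfderiv 𝓘(ℝ, ℝ) (𝓡 5) γ t (1 : ℝ) ∈ L (γ t)

end PathGeometry

/-- The point `(t, y(t), y'(t), y''(t), y'''(t))`. -/
def jet (y : ℝ → ℝ) (t : ℝ) : EuclideanSpace ℝ (Fin 5) :=
  !₂[t, y t, iteratedDeriv 1 y t, iteratedDeriv 2 y t, iteratedDeriv 3 y t]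

/-- `y` is a smooth solution, on the open interval `s`, of `y'''' = F(x, y, y', y'', y''')`, where
`F` is defined on `Ω`. -/
def IsSolutionOn (F : EuclideanSpace ℝ (Fin 5) → ℝ) (Ω : Set (EuclideanSpace ℝ (Fin 5)))
    (y : ℝ → ℝ) (s : Set ℝ) : Prop :=
  IsOpen s ∧ s.OrdConnected ∧ ContDiffOn ℝ ∞ y s ∧
    ∀ t ∈ s, jet y t ∈ Ω ∧ iteratedDeriv 4 y t = F (jet y t)

end ContactPath

end

noncomputable section

namespace ContactPath

/-! ### The smooth inverse function theorem as a local diffeomorphism -/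

section InverseFunction

variable {E F : Type*} [NormedAddCommGroup E] [NormedSpace ℝ E] [CompleteSpace E]
  [NormedAddCommGroup F] [NormedSpace ℝ F]

/-! Near `q`, contact coordinates on the base (`exists_contact_functions`) make D the kernel of dy -
p dx, with dx nonzero on the image of L. Pull x, y, p back to P and call them x, y₀, y₁. Since L
projects into D, dy₀ = y₁ dx on L. Let T be the local section of L with dx(T) = 1 and define y₂ = T
y₁, y₃ = T y₂, y₄ = T y₃. Then every θᵢ = dyᵢ - yᵢ₊₁ dx vanishes on L, and dθᵢ = dx ∧ dyᵢ₊₁ = dx ∧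
θᵢ₊₁ because dx ∧ dx = 0. With σ = -dx these are the structure equations, without remainder.

The rank hypotheses serve to show that dx, θ₀, …, θ₃ are independent
(`IsAdapted.linearIndependent`). The fibres of ρ are the common kernel of dx, dy₀, dy₁, so I is
spanned by the independent forms θ₀, θ₁. If θ₂ lay in I at a point, then θ₀ and θ₁ would both lie in
I' there, which is one-dimensional. Next, θ₂ kills the Cauchy characteristic vectors of I and
belongs to J. If θ₃ lay in the span of θ₀, θ₁, θ₂ at a point, then θ₂ would lie in J' = I there,
which has just been excluded.

Hence x, y₀, …, y₃ are coordinates by the inverse function theorem, F is y₄ in these coordinates,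
and L is the common kernel of θ₀, …, θ₃. Along a curve tangent to L one has yᵢ' = yᵢ₊₁ x', and x' ≠
0 by immersion; after reparametrisation by x this is the differential equation, and the computation
reverses.

The contact coordinates come from straightening a section V of D. Two first integrals x, y of V give
α = a dx + c dy, and p = -a/c is the third coordinate because α ∧ dα ≠ 0. Straightening requires a
flow that is jointly smooth (`exists_smooth_flow`); it is obtained by applying the inverse function
theorem in C([0,1], E) to the integral equation u = y + ε ∫ V(u). -/

theorem exists_localDiffeomorph {f : E → F} {U : Set E} (hU : IsOpen U) (hf : ContDiffOn ℝ ∞ f U)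
    {a : E} (ha : a ∈ U) {f' : E ≃L[ℝ] F} (hf' : HasFDerivAt f (f' : E →L[ℝ] F) a) :
    ∃ e : OpenPartialHomeomorph E F, a ∈ e.source ∧ e.source ⊆ U ∧ (∀ z, e z = f z) ∧
      ContDiffOn ℝ ∞ e.symm e.target := by
  have hfa : ContDiffAt ℝ ∞ f a := hf.contDiffAt (hU.mem_nhds ha)
  let e₀ := hfa.toOpenPartialHomeomorph f hf' (by simp)
  have he₀ : ∀ z, e₀ z = f z := fun z => rfl
  have ha₀ : a ∈ e₀.source := hfa.mem_toOpenPartialHomeomorph_source hf' (by simp)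
  -- Smoothness of the inverse at a point needs an invertible derivative at its preimage.
  -- Invertibility is an open condition, so the source is shrunk until it holds throughout.
  have hinv : ∀ᶠ z in 𝓝 a, fderiv ℝ f z ∈ Set.range ((↑) : (E ≃L[ℝ] F) → E →L[ℝ] F) := by
    have hc : ContinuousAt (fderiv ℝ f) a :=
      (hfa.fderiv_right (m := 0) (by simp)).continuousAt
    refine hc.eventually ?_
    rw [hf'.fderiv]
    exact ContinuousLinearEquiv.nhds f'
  obtain ⟨V, hVs, hVo, haV⟩ := mem_nhds_iff.1 (hinv.and (hU.mem_nhds ha))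
  refine ⟨e₀.restrOpen V hVo, ⟨ha₀, haV⟩, fun z hz => (hVs hz.2).2, he₀, ?_⟩
  intro w hw
  set e := e₀.restrOpen V hVo
  have hz : e.symm w ∈ e.source := e.map_target hw
  obtain ⟨⟨g, hg⟩, hzU⟩ := hVs hz.2
  have hd : ContDiffAt ℝ ∞ f (e.symm w) := hf.contDiffAt (hU.mem_nhds hzU)
  have : HasFDerivAt e (g : E →L[ℝ] F) (e.symm w) := by
    rw [hg]
    exact (hd.differentiableAt (by simp)).hasFDerivAt
  exact (e.contDiffAt_symm hw this hd).contDiffWithinAt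

end InverseFunction

/-! ### Smoothness of superposition operators on spaces of continuous functions -/

section Superposition

universe u

/-- Pointwise application of operators to vectors, as a continuous bilinear map. -/
def pointwiseApply (K : Type*) [TopologicalSpace K] [CompactSpace K]
    (E F : Type*) [NormedAddCommGroup E] [NormedSpace ℝ E]
    [NormedAddCommGroup F] [NormedSpace ℝ F] : C(K, E →L[ℝ] F) →L[ℝ] C(K, E) →L[ℝ] C(K, F) :=
  LinearMap.mkContinuous₂
    (LinearMap.mk₂ ℝ (fun (A : C(K, E →L[ℝ] F)) (h : C(K, E)) =>
        (⟨fun t => A t (h t), by fun_prop⟩ : C(K, F)))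
      (fun _ _ _ => by ext; simp) (fun _ _ _ => by ext; simp)
      (fun _ _ _ => by ext; simp) (fun _ _ _ => by ext; simp)) 1
    (fun A h => by
      rw [one_mul, ContinuousMap.norm_le _ (by positivity)]
      intro t
      exact (A t).le_of_opNorm_le_of_le (A.norm_coe_le_norm t) (h.norm_coe_le_norm t))

variable {K : Type*} [TopologicalSpace K] [CompactSpace K]
  {E F : Type u} [NormedAddCommGroup E] [NormedSpace ℝ E]
  [NormedAddCommGroup F] [NormedSpace ℝ F]

/-- The mean value inequality on a ball about `u t` bounds the remainder at each `t`; compactness of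
`K` enters through continuity of `w ↦ V' ∘ w` in the sup norm, which gives one radius for all `t`.
-/
theorem hasFDerivAt_postcomp (V : C(E, F)) (V' : C(E, E →L[ℝ] F))
    (hV : ∀ x, HasFDerivAt V (V' x) x) (u : C(K, E)) :
    HasFDerivAt (fun w : C(K, E) => V.comp w) (pointwiseApply K E F (V'.comp u)) u := by
  rw [hasFDerivAt_iff_isLittleO, Asymptotics.isLittleO_iff]
  intro ε hε
  have hc : ContinuousAt (fun w : C(K, E) => V'.comp w) u :=
    (ContinuousMap.continuous_postcomp V').continuousAt
  obtain ⟨δ, hδ, hclose⟩ :=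
    (Metric.continuousAt_iff (α := C(K, E)) (β := C(K, E →L[ℝ] F))).1 hc ε hε
  filter_upwards [Metric.ball_mem_nhds u hδ] with w hw
  rw [ContinuousMap.norm_le _ (by positivity)]
  intro t
  have hwt : ‖w t - u t‖ ≤ ‖w - u‖ := (w - u).norm_coe_le_norm t
  have hbound : ∀ x ∈ Metric.ball (u t) δ, ‖V' x - V' (u t)‖ ≤ ε := by
    intro x hx
    -- Shifting `u` by a constant reaches any `x` near `u t` while staying equally close to `u` in
    -- sup norm.
    have h1 : dist (u + ContinuousMap.const K (x - u t)) u < δ := by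
      rw [dist_eq_norm, add_sub_cancel_left]
      refine (ContinuousMap.norm_le _ (norm_nonneg (x - u t))).2 (fun _ => le_rfl) |>.trans_lt ?_
      rwa [Metric.mem_ball, dist_eq_norm] at hx
    have h2 := (ContinuousMap.dist_apply_le_dist t).trans (hclose h1).le
    simpa [dist_eq_norm] using h2
  have hmem : w t ∈ Metric.ball (u t) δ := by
    rw [Metric.mem_ball, dist_eq_norm]
    rw [Metric.mem_ball, dist_eq_norm] at hw
    exact hwt.trans_lt hw
  have := (convex_ball (u t) δ).norm_image_sub_le_of_norm_hasFDerivWithin_le'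
    (f := V) (f' := fun x => V' x) (φ := V' (u t)) (C := ε)
    (fun x _ => (hV x).hasFDerivWithinAt) hbound (Metric.mem_ball_self hδ) hmem
  calc ‖V (w t) - V (u t) - V' (u t) (w t - u t)‖ ≤ ε * ‖w t - u t‖ := this
    _ ≤ ε * ‖w - u‖ := by gcongr

/-- The derivative of superposition by `V` is superposition by `V'` followed by a bounded bilinear
map, so induction on the order works. `F` varies in the induction because `V'` takes values in `E
→L[ℝ] F`; this is also why `E` and `F` share a universe. -/
theorem contDiff_postcomp (n : ℕ) : ∀ {F : Type u} [NormedAddCommGroup F] [NormedSpace ℝ F]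
    (V : C(E, F)), ContDiff ℝ ∞ V → ContDiff ℝ n (fun w : C(K, E) => V.comp w) := by
  induction n with
  | zero =>
    intro F _ _ V _
    exact contDiff_zero.2 (ContinuousMap.continuous_postcomp V)
  | succ n ih =>
    intro F _ _ V hV
    have hV' : ContDiff ℝ ∞ (fderiv ℝ V) := hV.fderiv_right (by simp)
    let V' : C(E, E →L[ℝ] F) := ⟨fderiv ℝ V, hV'.continuous⟩
    push_cast
    refine contDiff_succ_iff_hasFDerivAt.2
      ⟨fun u => pointwiseApply K E F (V'.comp u), ?_, fun u => hasFDerivAt_postcomp V V'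
        (fun x => (hV.differentiable (by simp) x).hasFDerivAt) u⟩
    exact (pointwiseApply K E F).contDiff.comp (ih V' hV')

end Superposition

/-! ### Smooth local flows -/

section Flow

universe u

variable {E : Type u} [NormedAddCommGroup E] [NormedSpace ℝ E] [CompleteSpace E]

/-- The primitive, vanishing at `0`, of a continuous curve parametrised by the unit interval. -/
def primitiveCLM (E : Type*) [NormedAddCommGroup E] [NormedSpace ℝ E] [CompleteSpace E] :
    C(unitInterval, E) →L[ℝ] C(unitInterval, E) :=
  LinearMap.mkContinuous
    { toFun := fun u => ⟨fun t => ∫ s in (0 : ℝ)..t, Set.IccExtend zero_le_one u s, by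
        have h : Continuous fun t : ℝ => ∫ s in (0 : ℝ)..t, Set.IccExtend zero_le_one u s :=
          intervalIntegral.continuous_primitive
            (fun a b => (u.continuous.Icc_extend' ).intervalIntegrable a b) 0
        exact h.comp continuous_subtype_val⟩
      map_add' := fun u v => by
        ext t
        exact intervalIntegral.integral_add
          (u.continuous.Icc_extend'.intervalIntegrable _ _)
          (v.continuous.Icc_extend'.intervalIntegrable _ _)
      map_smul' := fun c u => by
        ext t
        exact intervalIntegral.integral_smul c _ } 1
    (fun u => by
      rw [one_mul, ContinuousMap.norm_le _ (norm_nonneg u)]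
      intro t
      have := intervalIntegral.norm_integral_le_of_norm_le_const (a := 0) (b := (t : ℝ)) (C := ‖u‖)
        (f := Set.IccExtend zero_le_one u) (fun s _ => u.norm_coe_le_norm _)
      refine this.trans ?_
      rw [sub_zero, abs_of_nonneg t.2.1]
      exact mul_le_of_le_one_right (norm_nonneg u) t.2.2)

theorem norm_primitiveCLM_le (u : C(unitInterval, E)) : ‖primitiveCLM E u‖ ≤ ‖u‖ := by
  have := (primitiveCLM E).le_of_opNorm_le (LinearMap.mkContinuous_norm_le _ zero_le_one _) u
  rwa [one_mul] at this

/-- `u` solves `u' = ε V(u)`, `u(0) = y`, on the unit interval, in integral form. -/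
def IsScaledSolution (V : C(E, E)) (ε : ℝ) (y : E) (u : C(unitInterval, E)) : Prop :=
  u = ContinuousMap.const _ y + ε • primitiveCLM E (V.comp u)

/-- The integral operator is a contraction with factor `|ε| * C`. -/
theorem IsScaledSolution.unique {V : C(E, E)} {C : NNReal} (hL : LipschitzWith C V) {ε : ℝ} {y : E}
    (hε : |ε| * C < 1) {u w : C(unitInterval, E)} (hu : IsScaledSolution V ε y u)
    (hw : IsScaledSolution V ε y w) : u = w := by
  have h1 : u - w = ε • primitiveCLM E (V.comp u - V.comp w) := by
    rw [map_sub, smul_sub]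
    nth_rewrite 1 [hu, hw]
    abel
  have h2 : ‖V.comp u - V.comp w‖ ≤ C * ‖u - w‖ := by
    rw [ContinuousMap.norm_le _ (by positivity)]
    intro t
    refine (hL.norm_sub_le _ _).trans ?_
    gcongr
    exact (u - w).norm_coe_le_norm t
  have h3 : ‖u - w‖ ≤ (|ε| * C) * ‖u - w‖ := by
    calc ‖u - w‖ = |ε| * ‖primitiveCLM E (V.comp u - V.comp w)‖ := by
          nth_rewrite 1 [h1]; rw [norm_smul, Real.norm_eq_abs]
      _ ≤ |ε| * (C * ‖u - w‖) := by
          gcongr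
          exact (norm_primitiveCLM_le _).trans h2
      _ = _ := by ring
  have h4 : ‖u - w‖ = 0 := by nlinarith [norm_nonneg (u - w)]
  exact sub_eq_zero.1 (norm_eq_zero.1 h4)

theorem IsScaledSolution.apply {V : C(E, E)} {ε : ℝ} {y : E} {u : C(unitInterval, E)}
    (hu : IsScaledSolution V ε y u) (t : unitInterval) :
    u t = y + ε • ∫ s in (0 : ℝ)..t, V (Set.IccExtend zero_le_one u s) := by
  nth_rewrite 1 [hu]
  rfl

/-- Slowing a solution down by the factor `r` reduces its speed parameter to `r * ε`. This
identifies the time-one values for smaller parameters with intermediate values of a single solution.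
-/
theorem IsScaledSolution.rescale {V : C(E, E)} {ε : ℝ} {y : E} {u : C(unitInterval, E)}
    (hu : IsScaledSolution V ε y u) (r : unitInterval) :
    IsScaledSolution V (r * ε) y (u.comp ⟨fun t => r * t, by fun_prop⟩) := by
  ext t
  change u (r * t) = y + ((r : ℝ) * ε) • ∫ s in (0 : ℝ)..t, _
  rw [hu.apply, mul_comm (r : ℝ) ε, mul_smul]
  congr 2
  have h := intervalIntegral.smul_integral_comp_mul_left (a := 0) (b := (t : ℝ))
    (fun s => V (Set.IccExtend zero_le_one u s)) (r : ℝ)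
  rw [mul_zero] at h
  change _ = ∫ s in (0 : ℝ)..((r : ℝ) * t), _ at h
  rw [Set.Icc.coe_mul, ← h]
  congr 1
  refine intervalIntegral.integral_congr (fun s hs => ?_)
  rw [Set.uIcc_of_le t.2.1] at hs
  have hs1 : s ∈ Set.Icc (0 : ℝ) 1 := ⟨hs.1, hs.2.trans t.2.2⟩
  have hrs : (r : ℝ) * s ∈ Set.Icc (0 : ℝ) 1 := (r * ⟨s, hs1⟩ : unitInterval).2
  simp only [Set.IccExtend_of_mem _ _ hrs]
  change _ = V (Set.IccExtend zero_le_one _ s)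
  rw [Set.IccExtend_of_mem _ _ hs1]
  rfl

/-- The equation satisfied by the scaled solutions, augmented by the parameters. -/
def scaledEquation (V : C(E, E)) (q : (ℝ × E) × C(unitInterval, E)) :
    (ℝ × E) × C(unitInterval, E) :=
  (q.1, q.2 - (ContinuousMap.const _ q.1.2 + q.1.1 • primitiveCLM E (V.comp q.2)))

/-- The constant curves, as a continuous linear map. -/
def constCurve (E : Type*) [NormedAddCommGroup E] [NormedSpace ℝ E] :
    E →L[ℝ] C(unitInterval, E) where
  toFun := ContinuousMap.const _
  map_add' _ _ := rfl
  map_smul' _ _ := rfl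
  cont := ContinuousMap.continuous_const'

theorem contDiff_scaledEquation {V : C(E, E)} (hV : ContDiff ℝ ∞ V) :
    ContDiff ℝ ∞ (scaledEquation V) := by
  have h1 : ContDiff ℝ ∞ (fun w : C(unitInterval, E) => V.comp w) :=
    contDiff_infty.2 fun n => contDiff_postcomp n V hV
  have h2 : ContDiff ℝ ∞ (fun q : (ℝ × E) × C(unitInterval, E) => primitiveCLM E (V.comp q.2)) :=
    (primitiveCLM E).contDiff.comp (h1.comp contDiff_snd)
  have h3 : ContDiff ℝ ∞ (fun q : (ℝ × E) × C(unitInterval, E) => constCurve E q.1.2) := by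
    fun_prop
  exact contDiff_fst.prodMk (contDiff_snd.sub (h3.add (contDiff_fst.fst.smul h2)))

/-- At speed 0 the nonlinear term is multiplied by zero, so its derivative in the curve drops out.
What remains is a shear over the parameters, hence invertible. -/
theorem hasFDerivAt_scaledEquation {V : C(E, E)} (hV : ContDiff ℝ ∞ V) (z : E) :
    ∃ f' : ((ℝ × E) × C(unitInterval, E)) ≃L[ℝ] ((ℝ × E) × C(unitInterval, E)),
      HasFDerivAt (scaledEquation V) (f' : _ →L[ℝ] _) ((0, z), ContinuousMap.const _ z) := by
  have h1 : ContDiff ℝ ∞ (fun w : C(unitInterval, E) => V.comp w) :=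
    contDiff_infty.2 fun n => contDiff_postcomp n V hV
  have h2 : ContDiff ℝ ∞ (fun q : (ℝ × E) × C(unitInterval, E) => primitiveCLM E (V.comp q.2)) :=
    (primitiveCLM E).contDiff.comp (h1.comp contDiff_snd)
  set q₀ : (ℝ × E) × C(unitInterval, E) := ((0, z), ContinuousMap.const _ z) with hq₀
  have h3 := (h2.differentiable (by simp) q₀).hasFDerivAt
  have hfst : HasFDerivAt (fun q : (ℝ × E) × C(unitInterval, E) => q.1)
    (ContinuousLinearMap.fst ℝ _ _) q₀ := hasFDerivAt_fst
  have h4 : HasFDerivAt (fun q : (ℝ × E) × C(unitInterval, E) => q.1.1)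
    ((ContinuousLinearMap.fst ℝ _ _).comp (ContinuousLinearMap.fst ℝ _ _)) q₀ := hfst.fst
  have h5 : HasFDerivAt (fun q : (ℝ × E) × C(unitInterval, E) => constCurve E q.1.2)
    ((constCurve E).comp ((ContinuousLinearMap.snd ℝ _ _).comp (ContinuousLinearMap.fst ℝ _ _)))
      q₀ := (constCurve E).hasFDerivAt.comp q₀ hfst.snd
  have h6 := hfst.prodMk ((hasFDerivAt_snd (𝕜 := ℝ) (p := q₀)).sub (h5.add (h4.smul h3)))
  refine ⟨ContinuousLinearEquiv.skewProd (.refl ℝ _) (.refl ℝ _)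
    (-((constCurve E).comp (ContinuousLinearMap.snd ℝ _ _) +
      (ContinuousLinearMap.fst ℝ ℝ E).smulRight (primitiveCLM E (V.comp q₀.2)))), ?_⟩
  have h7 : HasFDerivAt (scaledEquation V) _ q₀ := h6
  refine h7.congr_fderiv (ContinuousLinearMap.ext fun x => Prod.ext rfl ?_)
  change x.2 - (constCurve E x.1.2 + ((0 : ℝ) • _ + x.1.1 • primitiveCLM E (V.comp q₀.2))) =
    x.2 + -(constCurve E x.1.2 + x.1.1 • primitiveCLM E (V.comp q₀.2))
  rw [zero_smul, zero_add, sub_eq_add_neg]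

/-- Smooth dependence on time and initial values for an autonomous equation. -/
theorem exists_smooth_flow {V : E → E} (hV : ContDiff ℝ ∞ V) {C : NNReal} (hL : LipschitzWith C V)
    (z : E) :
    ∃ (Φ : ℝ × E → E) (N : Set (ℝ × E)), IsOpen N ∧ ((0 : ℝ), z) ∈ N ∧ ContDiffOn ℝ ∞ Φ N ∧
      (∀ y, ((0 : ℝ), y) ∈ N → Φ (0, y) = y) ∧
      ∀ p ∈ N, HasDerivAt (fun ε => Φ (ε, p.2)) (V (Φ p)) p.1 := by
  let W : C(E, E) := ⟨V, hV.continuous⟩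
  obtain ⟨f', hf'⟩ := hasFDerivAt_scaledEquation (V := W) hV z
  obtain ⟨e, hmem, -, he, hes⟩ := exists_localDiffeomorph isOpen_univ
    (contDiff_scaledEquation (V := W) hV).contDiffOn (Set.mem_univ _) hf'
  -- The second component 0 says that the equation holds exactly, so the local inverse along `j` is
  -- the solution as a smooth function of speed and initial value.
  let j : ℝ × E → (ℝ × E) × C(unitInterval, E) := fun p => (p, 0)
  have hj : ContDiff ℝ ∞ j := contDiff_id.prodMk contDiff_const
  let N₀ : Set (ℝ × E) := j ⁻¹' e.target
  have hN₀ : IsOpen N₀ := e.open_target.preimage hj.continuous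
  let u : ℝ × E → C(unitInterval, E) := fun p => (e.symm (j p)).2
  have hu : ContDiffOn ℝ ∞ u N₀ := (hes.comp hj.contDiffOn (fun p hp => hp)).snd
  have hsol : ∀ p ∈ N₀, IsScaledSolution W p.1 p.2 (u p) := by
    intro p hp
    have h1 : scaledEquation W (e.symm (j p)) = j p := by rw [← he, e.right_inv hp]
    have h2 : (e.symm (j p)).1 = p := congrArg Prod.fst h1
    have h3 := congrArg Prod.snd h1
    simp only [scaledEquation, h2] at h3
    exact sub_eq_zero.1 h3
  have hz₀ : ((0 : ℝ), z) ∈ N₀ := by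
    have h1 : scaledEquation W ((0, z), ContinuousMap.const _ z) = j (0, z) := by
      simp [scaledEquation, j]
    have := e.map_source hmem
    rwa [he, h1] at this
  let d : ℝ × E → ℝ × E := fun p => (2 * p.1, p.2)
  have hd : Continuous d := by fun_prop
  -- The solution of speed 2ε is required as well, so that time ε falls in the interior of its
  -- interval. The last condition gives uniqueness for all speeds up to 2ε.
  let N : Set (ℝ × E) := (N₀ ∩ d ⁻¹' N₀) ∩ {p | |2 * p.1| * C < 1}
  have hN : IsOpen N := (hN₀.inter (hN₀.preimage hd)).inter
    (isOpen_lt (by fun_prop) continuous_const)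
  let Φ : ℝ × E → E := fun p => u p 1
  have hΦ : ContDiffOn ℝ ∞ Φ N := by
    have : ContDiff ℝ ∞ (fun w : C(unitInterval, E) => w 1) :=
      (ContinuousMap.evalCLM ℝ (1 : unitInterval) : C(unitInterval, E) →L[ℝ] E).contDiff
    exact this.comp_contDiffOn (hu.mono fun p hp => hp.1.1)
  have hne : ∀ p ∈ N, p.1 ≠ 0 → HasDerivAt (fun ε => Φ (ε, p.2)) (V (Φ p)) p.1 := by
    rintro ⟨ε, y⟩ ⟨⟨hp, hp2⟩, hpC⟩ (hε : ε ≠ 0)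
    have hs := hsol _ hp2
    set g : ℝ → E := fun s => V (Set.IccExtend zero_le_one (u (2 * ε, y)) s) with hg
    have hgc : Continuous g := hV.continuous.comp (u (2 * ε, y)).continuous.Icc_extend'
    have hscale : ∀ r : unitInterval, ((r : ℝ) * (2 * ε), y) ∈ N₀ →
        Φ ((r : ℝ) * (2 * ε), y) = u (2 * ε, y) r := by
      intro r hr
      have h1 := hsol _ hr
      have h2 := hs.rescale r
      have h3 : |(r : ℝ) * (2 * ε)| * C < 1 := by
        refine lt_of_le_of_lt ?_ hpC
        rw [abs_mul, abs_of_nonneg r.2.1]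
        gcongr
        exact mul_le_of_le_one_left (abs_nonneg _) r.2.2
      have h4 := IsScaledSolution.unique (V := W) hL h3 h1 h2
      simp only [Φ, h4]
      change u (2 * ε, y) (r * 1) = _
      rw [mul_one]
    -- By rescaling and uniqueness, Φ at every time η near ε is read off the one solution of speed
    -- 2ε at the fraction η/(2ε). It is thus an integral with variable upper limit.
    have h5 : ∀ᶠ η in 𝓝 ε, Φ (η, y) = y + (2 * ε) • ∫ s in (0 : ℝ)..(η / (2 * ε)), g s := by
      have hc1 : ∀ᶠ η in 𝓝 ε, (η, y) ∈ N₀ :=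
        (Continuous.tendsto (by fun_prop : Continuous fun η : ℝ => (η, y)) ε).eventually
          (hN₀.mem_nhds hp)
      have hhalf : ε / (2 * ε) = 1 / 2 := by field_simp
      have hc2 : ∀ᶠ η in 𝓝 ε, η / (2 * ε) ∈ Set.Icc (0 : ℝ) 1 := by
        refine (Continuous.tendsto (by fun_prop : Continuous fun η : ℝ => η / (2 * ε))
          ε).eventually (Icc_mem_nhds ?_ ?_) <;> rw [hhalf] <;> norm_num
      filter_upwards [hc1, hc2] with η h1 h2
      have h3 : (((⟨η / (2 * ε), h2⟩ : unitInterval) : ℝ)) * (2 * ε) = η := by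
        change η / (2 * ε) * (2 * ε) = η
        field_simp
      have h4 := hscale ⟨η / (2 * ε), h2⟩ (by rwa [h3])
      rw [h3] at h4
      rw [h4, hs.apply]
      rfl
    have h6 : HasDerivAt (fun η => y + (2 * ε) • ∫ s in (0 : ℝ)..(η / (2 * ε)), g s)
        ((2 * ε) • ((1 / (2 * ε)) • g (ε / (2 * ε)))) ε := by
      have hi := (hgc.integral_hasStrictDerivAt 0 (ε / (2 * ε))).hasDerivAt
      have hq : HasDerivAt (fun η : ℝ => η / (2 * ε)) (1 / (2 * ε)) ε :=
        (hasDerivAt_id ε).div_const _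
      exact ((hi.scomp ε hq).const_smul (2 * ε)).const_add y
    have h7 : (2 * ε) • ((1 / (2 * ε)) • g (ε / (2 * ε))) = V (Φ (ε, y)) := by
      have hhalf : ε / (2 * ε) = 1 / 2 := by field_simp
      have hm : (1 / 2 : ℝ) ∈ Set.Icc (0 : ℝ) 1 := by norm_num
      rw [smul_smul, mul_one_div_cancel (by simpa using hε), one_smul, hg, hhalf]
      simp only [Set.IccExtend_of_mem _ _ hm]
      have h3 : (((⟨1 / 2, hm⟩ : unitInterval) : ℝ)) * (2 * ε) = ε := by
        change 1 / 2 * (2 * ε) = ε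
        ring
      have h4 := hscale ⟨1 / 2, hm⟩ (by rwa [h3])
      rw [h3] at h4
      rw [h4]
    rw [← h7]
    exact h6.congr_of_eventuallyEq h5
  refine ⟨Φ, N, hN, ⟨⟨hz₀, by simpa [d] using hz₀⟩, by simp⟩, hΦ, ?_, ?_⟩
  · intro y hy
    have := (hsol _ hy.1.1).apply 1
    simpa using this
  · rintro ⟨ε, y⟩ hp
    -- Time zero is excluded above by the division. There the derivative follows by continuity from
    -- its punctured neighbourhood.
    by_cases hε : ε = 0
    · subst hε
      have hι : ContDiff ℝ ∞ (fun η : ℝ => (η, y)) := by fun_prop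
      let S : Set ℝ := (fun η : ℝ => (η, y)) ⁻¹' N
      have hS : IsOpen S := hN.preimage hι.continuous
      have h0 : (0 : ℝ) ∈ S := hp
      have hf : ContDiffOn ℝ ∞ (fun η => Φ (η, y)) S := hΦ.comp hι.contDiffOn (fun η h => h)
      have hdiff : HasDerivAt (fun η => Φ (η, y)) (deriv (fun η => Φ (η, y)) 0) 0 :=
        ((hf.contDiffAt (hS.mem_nhds h0)).differentiableAt (by simp)).hasDerivAt
      have hdc : ContinuousAt (deriv (fun η => Φ (η, y))) 0 :=
        ((hf.deriv_of_isOpen (m := 0) hS (by simp)).continuousOn).continuousAt (hS.mem_nhds h0)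
      have hVc : ContinuousAt (fun η => V (Φ (η, y))) 0 :=
        hV.continuous.continuousAt.comp hdiff.continuousAt
      have heq : deriv (fun η => Φ (η, y)) =ᶠ[𝓝[≠] 0] fun η => V (Φ (η, y)) := by
        filter_upwards [self_mem_nhdsWithin, mem_nhdsWithin_of_mem_nhds (hS.mem_nhds h0)]
          with η h1 h2
        exact (hne (η, y) h2 h1).deriv
      have := tendsto_nhds_unique ((hdc.tendsto.mono_left nhdsWithin_le_nhds).congr' heq)
        (hVc.tendsto.mono_left nhdsWithin_le_nhds)
      rw [this] at hdiff
      exact hdiff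
    · exact hne _ hp hε

end Flow

/-! ### Straightening a vector field -/

section Straighten

variable {E : Type*} [NormedAddCommGroup E] [NormedSpace ℝ E] [FiniteDimensional ℝ E]

/-- Near a point where it does not vanish, a smooth vector field is the image of a constant one
under a local diffeomorphism that is tangent to the identity at this point. -/
theorem exists_straightening {V : E → E} {U : Set E} (hU : IsOpen U) (hV : ContDiffOn ℝ ∞ V U)
    {z : E} (hz : z ∈ U) (hVz : V z ≠ 0) :
    ∃ (G : E → E) (N : Set E), IsOpen N ∧ z ∈ N ∧ N ⊆ U ∧ ContDiffOn ℝ ∞ G N ∧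
      fderiv ℝ G z = ContinuousLinearMap.id ℝ E ∧ ∀ w ∈ N, fderiv ℝ G w (V w) = V z := by
  obtain ⟨r, hr, hrU⟩ := Metric.nhds_basis_closedBall.mem_iff.1 (hU.mem_nhds hz)
  -- The cut-off makes the field global and Lipschitz, without changing it near `z`.
  let b : ContDiffBump z := ⟨r / 2, r, half_pos hr, half_lt_self hr⟩
  have hbU : tsupport b ⊆ U := b.tsupport_eq.trans_subset hrU
  let X : E → E := fun w => b w • V w
  have hX : ContDiff ℝ ∞ X := by
    rw [contDiff_iff_contDiffAt]
    intro w
    by_cases hw : w ∈ U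
    · exact b.contDiffAt.smul (hV.contDiffAt (hU.mem_nhds hw))
    · have h0 : X =ᶠ[𝓝 w] fun _ => 0 := by
        filter_upwards [notMem_tsupport_iff_eventuallyEq.1 fun h => hw (hbU h)] with y hy
        simp [X, hy]
      exact contDiffAt_const.congr_of_eventuallyEq h0
  have hXb : ∀ w ∈ Metric.ball z (r / 2), X w = V w := by
    intro w hw
    simp only [X, b.one_of_mem_closedBall (Metric.ball_subset_closedBall hw), one_smul]
  have hXz : X z = V z := hXb z (Metric.mem_ball_self (half_pos hr))
  obtain ⟨C, hC⟩ := hX.lipschitzWith_of_hasCompactSupport b.hasCompactSupport.smul_right (by simp)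
  obtain ⟨Φ, M, hM, hzM, hΦ, hΦ0, hΦV⟩ := exists_smooth_flow hX hC z
  obtain ⟨l, hl⟩ := SeparatingDual.exists_eq_one (R := ℝ) hVz
  -- `a` splits a point into its height `l (w - z)` and its projection along `V z` to the hyperplane
  -- of height zero. `Ψ` flows the projection for a time equal to the height, so moving along `V z`
  -- only changes the time.
  let a : E → ℝ × E := fun w => (l (w - z), w - l (w - z) • V z)
  have ha : ContDiff ℝ ∞ a := by fun_prop
  have haz : a z = (0, z) := by simp [a]
  let S : Set E := a ⁻¹' M
  have hS : IsOpen S := hM.preimage ha.continuous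
  have hzS : z ∈ S := by change a z ∈ M; rwa [haz]
  let Ψ : E → E := fun w => Φ (a w)
  have hΨ : ContDiffOn ℝ ∞ Ψ S := hΦ.comp ha.contDiffOn fun w hw => hw
  have hΨd : ∀ w ∈ S, HasFDerivAt Ψ (fderiv ℝ Ψ w) w := fun w hw =>
    ((hΨ.contDiffAt (hS.mem_nhds hw)).differentiableAt (by simp)).hasFDerivAt
  have hΨz : Ψ z = z := by
    change Φ (a z) = z
    rw [haz]
    exact hΦ0 z hzM
  have hΨV : ∀ w ∈ S, fderiv ℝ Ψ w (V z) = X (Ψ w) := by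
    intro w hw
    have h1 := hΦV (a w) hw
    have h2 : HasDerivAt (fun s : ℝ => w + s • V z) (V z) 0 := by
      simpa using ((hasDerivAt_id (0 : ℝ)).smul_const (V z)).const_add w
    have h3 : HasDerivAt (fun s : ℝ => Ψ (w + s • V z)) (fderiv ℝ Ψ w (V z)) 0 := by
      have h6 : HasFDerivAt Ψ (fderiv ℝ Ψ w) (w + (0 : ℝ) • V z) := by simpa using hΨd w hw
      exact h6.comp_hasDerivAt (0 : ℝ) h2
    have h4 : HasDerivAt (fun s : ℝ => l (w - z) + s) 1 0 := by
      simpa using (hasDerivAt_id (0 : ℝ)).const_add (l (w - z))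
    have h5 : HasDerivAt (fun s : ℝ => Φ (l (w - z) + s, (a w).2)) (X (Ψ w)) 0 := by
      have h6 : HasDerivAt (fun ε => Φ (ε, (a w).2)) (X (Ψ w)) (l (w - z) + 0) := by
        rw [add_zero]
        exact h1
      have h7 := h6.scomp (0 : ℝ) h4
      rwa [one_smul] at h7
    refine h3.unique (h5.congr_of_eventuallyEq (Filter.Eventually.of_forall fun s => ?_))
    change Φ (a (w + s • V z)) = _
    congr 1
    simp only [a, add_sub_right_comm, map_add, map_smul, hl, smul_eq_mul, mul_one, Prod.mk.injEq,
      true_and, add_smul]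
    abel
  -- The time-zero flow is the identity, and the time derivative at `z` is `V z`; these cover both
  -- summands of the splitting.
  have hΨid : fderiv ℝ Ψ z = ContinuousLinearMap.id ℝ E := by
    have hd : HasFDerivAt Φ (fderiv ℝ Φ (0, z)) (0, z) :=
      ((hΦ.contDiffAt (hM.mem_nhds hzM)).differentiableAt (by simp)).hasFDerivAt
    have h1 : ∀ y, fderiv ℝ Φ (0, z) (0, y) = y := by
      intro y
      have hι : HasFDerivAt (fun y : E => ((0 : ℝ), y)) (ContinuousLinearMap.inr ℝ ℝ E) z :=
        (ContinuousLinearMap.inr ℝ ℝ E).hasFDerivAt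
      have h2 : HasFDerivAt (fun y : E => Φ (0, y)) _ z := HasFDerivAt.comp z hd hι
      have h3 : (fun y : E => Φ (0, y)) =ᶠ[𝓝 z] id := by
        filter_upwards [hι.continuousAt.preimage_mem_nhds (hM.mem_nhds hzM)] with y hy
        exact hΦ0 y hy
      have h4 := (h2.congr_of_eventuallyEq h3.symm).unique (hasFDerivAt_id z)
      simpa using congrArg (fun A : E →L[ℝ] E => A y) h4
    have hda : HasFDerivAt a (l.prod (ContinuousLinearMap.id ℝ E - l.smulRight (V z))) z := by
      have h2 : HasFDerivAt (fun w => l (w - z)) l z :=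
        l.hasFDerivAt.comp z ((hasFDerivAt_id z).sub_const z)
      exact h2.prodMk ((hasFDerivAt_id z).sub (h2.smul_const (V z)))
    have hd' : HasFDerivAt Φ (fderiv ℝ Φ (0, z)) (a z) := by rwa [haz]
    have h5 : HasFDerivAt Ψ _ z := hd'.comp z hda
    have h6 : fderiv ℝ Φ (0, z) (1, 0) = V z := by
      have h7 := hΨV z hzS
      rw [h5.fderiv, hΨz, hXz] at h7
      simpa [hl] using h7
    rw [h5.fderiv]
    ext h
    have h8 : ((l h, h - l h • V z) : ℝ × E) = l h • (1, 0) + (0, h - l h • V z) := by simp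
    change fderiv ℝ Φ (0, z) (l h, h - l h • V z) = h
    rw [h8, map_add, map_smul, h6, h1]
    abel
  obtain ⟨e, hze, heS, he, hes⟩ := exists_localDiffeomorph hS hΨ hzS
    (f' := ContinuousLinearEquiv.refl ℝ E) (by
      have := hΨd z hzS
      rw [hΨid] at this
      exact this)
  have hzt : z ∈ e.target := by
    have := e.map_source hze
    rwa [he, hΨz] at this
  have hez : e.symm z = z := by
    have := e.left_inv hze
    rwa [he, hΨz] at this
  have hG : ∀ w ∈ e.target, ∀ h, fderiv ℝ e.symm w (fderiv ℝ Ψ (e.symm w) h) = h := by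
    intro w hw h
    have hs := e.map_target hw
    have h1 : HasFDerivAt e.symm (fderiv ℝ e.symm w) (Ψ (e.symm w)) := by
      rw [← he, e.right_inv hw]
      exact ((hes.contDiffAt (e.open_target.mem_nhds hw)).differentiableAt (by simp)).hasFDerivAt
    have h2 := h1.comp _ (hΨd _ (heS hs))
    have h3 : e.symm ∘ Ψ =ᶠ[𝓝 (e.symm w)] id := by
      filter_upwards [e.open_source.mem_nhds hs] with y hy
      rw [Function.comp_apply, ← he, e.left_inv hy]
      rfl
    have h4 := (h2.congr_of_eventuallyEq h3.symm).unique (hasFDerivAt_id _)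
    -- Hence the inverse of `Ψ` carries the field back to the constant `V z`.
    simpa using congrArg (fun A : E →L[ℝ] E => A h) h4
  refine ⟨e.symm, e.target ∩ Metric.ball z (r / 2), e.open_target.inter Metric.isOpen_ball,
    ⟨hzt, Metric.mem_ball_self (half_pos hr)⟩, fun w hw => hrU ?_, hes.mono fun w hw => hw.1, ?_,
    ?_⟩
  · exact Metric.ball_subset_closedBall (Metric.ball_subset_ball (half_le_self hr.le) hw.2)
  · ext h
    have := hG z hzt h
    rw [hez, hΨid] at this
    exact this
  · intro w hw
    have h1 := hG w hw.1 (V z)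
    rwa [hΨV _ (heS (e.map_target hw.1)), ← he, e.right_inv hw.1, hXb w hw.2] at h1

end Straighten

/-! ### Normal form of a contact distribution in dimension three -/

section Darboux

variable {E : Type*} [NormedAddCommGroup E] [NormedSpace ℝ E]

theorem two_le_infty : (2 : WithTop ℕ∞) ≤ ∞ :=
  (WithTop.coe_le_coe (α := ℕ∞)).2 (le_top : (2 : ℕ∞) ≤ ⊤)

theorem exists_eq_combination_of_finrank_three (hE : Module.finrank ℝ E = 3) {u v w : E}
    (huvw : ∀ s t r : ℝ, s • u + t • v + r • w = 0 → s = 0 ∧ t = 0 ∧ r = 0) (h : E) :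
    ∃ s t r : ℝ, h = s • u + t • v + r • w := by
  have : FiniteDimensional ℝ E := Module.finite_of_finrank_pos (by omega)
  have hli : LinearIndependent ℝ ![u, v, w] := by
    rw [Fintype.linearIndependent_iff]
    intro g hg
    rw [Fin.sum_univ_three] at hg
    obtain ⟨h0, h1, h2⟩ := huvw (g 0) (g 1) (g 2) (by simpa using hg)
    intro i
    fin_cases i <;> assumption
  have htop := hli.span_eq_top_of_card_eq_finrank' (by simp [hE])
  have hh : h ∈ Submodule.span ℝ (Set.range ![u, v, w]) := by rw [htop]; trivial
  obtain ⟨c, hc⟩ := (Submodule.mem_span_range_iff_exists_fun ℝ).1 hh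
  refine ⟨c 0, c 1, c 2, ?_⟩
  rw [← hc, Fin.sum_univ_three]
  simp

/-- A covector `a` and a bilinear form `A` with `a ∧ dA ≠ 0` have no common degenerate vector. -/
theorem eq_zero_of_contact_degenerate (hE : Module.finrank ℝ E = 3) {a : E →L[ℝ] ℝ}
    {A : E →L[ℝ] E →L[ℝ] ℝ} {u v w : E}
    (hc : a u * (A v w - A w v) + a v * (A w u - A u w) + a w * (A u v - A v u) ≠ 0) {h : E}
    (hh : ∀ j k, a h * (A j k - A k j) + a j * (A k h - A h k) + a k * (A h j - A j h) = 0) :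
    h = 0 := by
  set δ := a u * (A v w - A w v) + a v * (A w u - A u w) + a w * (A u v - A v u) with hδ
  -- Contracting with two of `u`, `v`, `w` isolates one coefficient times `δ`. Applied to the zero
  -- vector, this shows that `u`, `v`, `w` are independent, hence a basis; applied to `h`, it gives
  -- the claim.
  have key : ∀ s t r : ℝ, ∀ k : E, k = s • u + t • v + r • w →
      (∀ j l, a k * (A j l - A l j) + a j * (A l k - A k l) + a l * (A k j - A j k) = 0) →
      s = 0 ∧ t = 0 ∧ r = 0 := by
    intro s t r k hk hkz
    have h1 : s * δ = 0 := by
      rw [← hkz v w, hk, hδ]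
      simp only [map_add, map_smul, add_apply, smul_apply, smul_eq_mul]
      ring
    have h2 : t * δ = 0 := by
      rw [← hkz w u, hk, hδ]
      simp only [map_add, map_smul, add_apply, smul_apply, smul_eq_mul]
      ring
    have h3 : r * δ = 0 := by
      rw [← hkz u v, hk, hδ]
      simp only [map_add, map_smul, add_apply, smul_apply, smul_eq_mul]
      ring
    exact ⟨(mul_eq_zero.1 h1).resolve_right hc, (mul_eq_zero.1 h2).resolve_right hc,
      (mul_eq_zero.1 h3).resolve_right hc⟩
  obtain ⟨s, t, r, hstr⟩ := exists_eq_combination_of_finrank_three hE (u := u) (v := v) (w := w)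
    (fun s t r h0 => key s t r 0 h0.symm (by simp)) h
  obtain ⟨hs, ht, hr⟩ := key s t r h hstr hh
  rw [hstr, hs, ht, hr]
  simp

theorem exists_mem_ker_notMem_span [FiniteDimensional ℝ E] (hE : Module.finrank ℝ E = 3)
    (a : E →L[ℝ] ℝ) (u : E) : ∃ v, a v = 0 ∧ v ∉ Submodule.span ℝ {u} := by
  by_contra! hcon
  have h1 : LinearMap.ker a.toLinearMap ≤ Submodule.span ℝ {u} := fun v hv => hcon v hv
  have h2 := Submodule.finrank_mono h1
  have h3 : Module.finrank ℝ (Submodule.span ℝ {u}) ≤ 1 :=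
    (finrank_span_le_card ({u} : Set E)).trans (by simp)
  have h4 := a.toLinearMap.finrank_range_add_finrank_ker
  have h5 : Module.finrank ℝ (LinearMap.range a.toLinearMap) ≤ 1 :=
    (Submodule.finrank_le _).trans (Module.finrank_self ℝ).le
  omega

/-- Near a given point, a contact distribution on a three-dimensional space is the kernel of
`dy - p dx` for a coordinate system `x, y, p`, in which `dx` does not vanish on a given vector of
the distribution. -/
theorem exists_contact_coordinates [FiniteDimensional ℝ E] (hE : Module.finrank ℝ E = 3)
    {α : E → E →L[ℝ] ℝ} {U : Set E} (hU : IsOpen U) (hα : ContDiffOn ℝ ∞ α U) {z : E} (hz : z ∈ U)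
    (hcontact : ∃ u v w, α z u * (fderiv ℝ α z v w - fderiv ℝ α z w v) +
      α z v * (fderiv ℝ α z w u - fderiv ℝ α z u w) +
      α z w * (fderiv ℝ α z u v - fderiv ℝ α z v u) ≠ 0)
    {u₀ : E} (hu₀ : u₀ ≠ 0) (hαu₀ : α z u₀ = 0) :
    ∃ (x y p : E → ℝ) (N : Set E), IsOpen N ∧ z ∈ N ∧ N ⊆ U ∧ ContDiffOn ℝ ∞ x N ∧
      ContDiffOn ℝ ∞ y N ∧ ContDiffOn ℝ ∞ p N ∧ fderiv ℝ x z u₀ ≠ 0 ∧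
      (∀ w ∈ N, ∀ h, α w h = 0 ↔ fderiv ℝ y w h = p w * fderiv ℝ x w h) ∧
      ∀ w ∈ N, ∀ h, fderiv ℝ x w h = 0 → fderiv ℝ y w h = 0 → fderiv ℝ p w h = 0 → h = 0 := by
  obtain ⟨n, hn⟩ : ∃ n, α z n ≠ 0 := by
    by_contra! h0
    obtain ⟨u, v, w, h⟩ := hcontact
    exact h (by simp [h0])
  -- `v₀` completes `u₀` to a basis of the contact plane at `z`. The section below passes through
  -- `v₀`, so its first integral `x`, built from a form with kernel containing `v₀` but not `u₀`,
  -- still varies along `u₀`.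
  obtain ⟨v₀, hv₀, hv₀u₀⟩ := exists_mem_ker_notMem_span hE (α z) u₀
  have hu₀v₀ : u₀ ∉ Submodule.span ℝ {v₀} := by
    intro h
    obtain ⟨c, hc⟩ := Submodule.mem_span_singleton.1 h
    have hc0 : c ≠ 0 := by rintro rfl; exact hu₀ (by simpa using hc.symm)
    exact hv₀u₀ (Submodule.mem_span_singleton.2 ⟨c⁻¹, by rw [← hc, inv_smul_smul₀ hc0]⟩)
  have hv₀0 : v₀ ≠ 0 := by rintro rfl; exact hv₀u₀ (Submodule.zero_mem _)
  obtain ⟨l₀, hl₀u, hl₀v⟩ := Submodule.exists_le_ker_of_notMem hu₀v₀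
  let l : E →L[ℝ] ℝ := LinearMap.toContinuousLinearMap l₀
  have hlu : l u₀ ≠ 0 := hl₀u
  have hlv : l v₀ = 0 := hl₀v (Submodule.mem_span_singleton_self v₀)
  -- a section of the distribution
  have hαc : ContinuousOn α U := hα.continuousOn
  have hαn : ContDiffOn ℝ ∞ (fun w => α w n) U := hα.clm_apply contDiffOn_const
  let U₁ : Set E := U ∩ (fun w => α w n) ⁻¹' {0}ᶜ
  have hU₁ : IsOpen U₁ := hαn.continuousOn.isOpen_inter_preimage hU isOpen_compl_singleton
  have hU₁U : U₁ ⊆ U := Set.inter_subset_left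
  have hzU₁ : z ∈ U₁ := ⟨hz, hn⟩
  -- The constant field `v₀`, corrected along the transverse vector `n` to lie in the kernel of `α`.
  let V : E → E := fun w => v₀ - (α w v₀ / α w n) • n
  have hV : ContDiffOn ℝ ∞ V U₁ :=
    contDiffOn_const.sub (((((hα.mono hU₁U).clm_apply contDiffOn_const).div (hαn.mono hU₁U)
      fun w hw => hw.2)).smul contDiffOn_const)
  have hVz : V z = v₀ := by simp [V, hv₀]
  have hαV : ∀ w ∈ U₁, α w (V w) = 0 := by
    intro w hw
    have : α w n ≠ 0 := hw.2
    simp only [V, map_sub, map_smul, smul_eq_mul]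
    field_simp
    ring
  -- its first integrals
  obtain ⟨G, N₁, hN₁, hzN₁, hN₁U, hG, hGz, hGV⟩ :=
    exists_straightening hU₁ hV hzU₁ (by rwa [hVz])
  rw [hVz] at hGV
  have hGd : ∀ w ∈ N₁, HasFDerivAt G (fderiv ℝ G w) w := fun w hw =>
    ((hG.contDiffAt (hN₁.mem_nhds hw)).differentiableAt (by simp)).hasFDerivAt
  -- `G` carries `V` to the constant `v₀`, so any linear form killing `v₀` pulls back to a first
  -- integral; `l` and `α z` are two independent ones.
  let x : E → ℝ := fun w => l (G w)
  let y : E → ℝ := fun w => α z (G w)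
  have hx : ContDiffOn ℝ ∞ x N₁ := l.contDiff.comp_contDiffOn hG
  have hy : ContDiffOn ℝ ∞ y N₁ := (α z).contDiff.comp_contDiffOn hG
  have hdx : ∀ w ∈ N₁, fderiv ℝ x w = l.comp (fderiv ℝ G w) := fun w hw =>
    (l.hasFDerivAt.comp w (hGd w hw)).fderiv
  have hdy : ∀ w ∈ N₁, fderiv ℝ y w = (α z).comp (fderiv ℝ G w) := fun w hw =>
    ((α z).hasFDerivAt.comp w (hGd w hw)).fderiv
  have hdxz : fderiv ℝ x z = l := by rw [hdx z hzN₁, hGz]; rfl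
  have hdyz : fderiv ℝ y z = α z := by rw [hdy z hzN₁, hGz]; rfl
  have hdxV : ∀ w ∈ N₁, fderiv ℝ x w (V w) = 0 := by
    intro w hw
    rw [hdx w hw, ContinuousLinearMap.comp_apply, hGV w hw, hlv]
  have hdyV : ∀ w ∈ N₁, fderiv ℝ y w (V w) = 0 := by
    intro w hw
    rw [hdy w hw, ContinuousLinearMap.comp_apply, hGV w hw, hv₀]
  have hx' : ContDiffOn ℝ ∞ (fderiv ℝ x) N₁ := hx.fderiv_of_isOpen hN₁ (by simp)
  have hy' : ContDiffOn ℝ ∞ (fderiv ℝ y) N₁ := hy.fderiv_of_isOpen hN₁ (by simp)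
  have hα₁ : ContDiffOn ℝ ∞ α N₁ := hα.mono (hN₁U.trans hU₁U)
  have hap : ∀ {β : E → E →L[ℝ] ℝ}, ContDiffOn ℝ ∞ β N₁ → ∀ k, ContDiffOn ℝ ∞ (fun w => β w k) N₁ :=
    fun hβ k => hβ.clm_apply contDiffOn_const
  -- Both `α` and the differentials of `x`, `y` kill `V`, so `α = a dx + c dy`. Cramer's rule on the
  -- vectors `u₀`, `n` supplies the smooth coefficients.
  let δ : E → ℝ := fun w => fderiv ℝ x w u₀ * fderiv ℝ y w n - fderiv ℝ x w n * fderiv ℝ y w u₀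
  have hδ : ContDiffOn ℝ ∞ δ N₁ := ((hap hx' _).mul (hap hy' _)).sub ((hap hx' _).mul (hap hy' _))
  let a : E → ℝ := fun w => (α w u₀ * fderiv ℝ y w n - α w n * fderiv ℝ y w u₀) / δ w
  let c : E → ℝ := fun w => (fderiv ℝ x w u₀ * α w n - fderiv ℝ x w n * α w u₀) / δ w
  let N₂ : Set E := N₁ ∩ δ ⁻¹' {0}ᶜ
  have hN₂ : IsOpen N₂ := hδ.continuousOn.isOpen_inter_preimage hN₁ isOpen_compl_singleton
  have hN₂N₁ : N₂ ⊆ N₁ := Set.inter_subset_left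
  have hδz : δ z = l u₀ * α z n := by simp [δ, hdxz, hdyz, hαu₀]
  have hzN₂ : z ∈ N₂ := ⟨hzN₁, by
    change δ z ≠ 0
    rw [hδz]
    exact mul_ne_zero hlu hn⟩
  have ha : ContDiffOn ℝ ∞ a N₂ := ContDiffOn.div ((((hap hα₁ _).mul (hap hy' _)).sub
    ((hap hα₁ _).mul (hap hy' _))).mono hN₂N₁) (hδ.mono hN₂N₁) fun w hw => hw.2
  have hc : ContDiffOn ℝ ∞ c N₂ := ContDiffOn.div ((((hap hx' _).mul (hap hα₁ _)).sub
    ((hap hx' _).mul (hap hα₁ _))).mono hN₂N₁) (hδ.mono hN₂N₁) fun w hw => hw.2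
  have haz : a z = 0 := by simp [a, hdyz, hαu₀]
  have hcz : c z = 1 := by
    simp only [c, hδz, hdxz, hαu₀, mul_zero, sub_zero]
    exact div_self (mul_ne_zero hlu hn)
  have hαac : ∀ w ∈ N₂, α w = a w • fderiv ℝ x w + c w • fderiv ℝ y w := by
    intro w hw
    have hδw : δ w ≠ 0 := hw.2
    have hVw : V w ≠ 0 := by
      intro h0
      have := hGV w hw.1
      rw [h0, map_zero] at this
      exact hv₀0 this.symm
    have hfun : α w u₀ = a w * fderiv ℝ x w u₀ + c w * fderiv ℝ y w u₀ := by
      simp only [a, c]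
      field_simp
      simp only [δ]
      ring
    have hfun' : α w n = a w * fderiv ℝ x w n + c w * fderiv ℝ y w n := by
      simp only [a, c]
      field_simp
      simp only [δ]
      ring
    ext h
    obtain ⟨s, t, r, rfl⟩ := exists_eq_combination_of_finrank_three hE
      (u := u₀) (v := n) (w := V w) (by
        intro s t r h0
        have h1 := congrArg (fderiv ℝ x w) h0
        have h2 := congrArg (fderiv ℝ y w) h0
        simp only [map_add, map_smul, smul_eq_mul, hdxV w hw.1, hdyV w hw.1, map_zero, mul_zero,
          add_zero] at h1 h2
        have hs : s * δ w = 0 := by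
          simp only [δ]
          linear_combination fderiv ℝ y w n * h1 - fderiv ℝ x w n * h2
        have ht : t * δ w = 0 := by
          simp only [δ]
          linear_combination fderiv ℝ x w u₀ * h2 - fderiv ℝ y w u₀ * h1
        have hs0 := (mul_eq_zero.1 hs).resolve_right hδw
        have ht0 := (mul_eq_zero.1 ht).resolve_right hδw
        rw [hs0, ht0, zero_smul, zero_smul, zero_add, zero_add] at h0
        exact ⟨hs0, ht0, (smul_eq_zero.1 h0).resolve_right hVw⟩) h
    simp only [map_add, map_smul, smul_eq_mul, add_apply, smul_apply, hαV w (hN₁U hw.1),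
      hdxV w hw.1, hdyV w hw.1, hfun, hfun']
    ring
  -- the third coordinate
  let N₃ : Set E := N₂ ∩ c ⁻¹' {0}ᶜ
  have hN₃ : IsOpen N₃ := hc.continuousOn.isOpen_inter_preimage hN₂ isOpen_compl_singleton
  have hzN₃ : z ∈ N₃ := ⟨hzN₂, by change c z ≠ 0; rw [hcz]; exact one_ne_zero⟩
  let p : E → ℝ := fun w => -a w / c w
  have hp : ContDiffOn ℝ ∞ p N₃ :=
    ((ha.mono Set.inter_subset_left).neg).div (hc.mono Set.inter_subset_left) fun w hw => hw.2
  have hN₃N₁ : N₃ ⊆ N₁ := fun w hw => hw.1.1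
  have hp' : ContDiffOn ℝ ∞ (fderiv ℝ p) N₃ := hp.fderiv_of_isOpen hN₃ (by simp)
  have had : HasFDerivAt a (fderiv ℝ a z) z :=
    ((ha.contDiffAt (hN₂.mem_nhds hzN₂)).differentiableAt (by simp)).hasFDerivAt
  have hcd : HasFDerivAt c (fderiv ℝ c z) z :=
    ((hc.contDiffAt (hN₂.mem_nhds hzN₂)).differentiableAt (by simp)).hasFDerivAt
  have hpz : fderiv ℝ p z = -fderiv ℝ a z := by
    have h1 : a =ᶠ[𝓝 z] fun w => -(p w * c w) := by
      filter_upwards [hN₃.mem_nhds hzN₃] with w hw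
      have : c w ≠ 0 := hw.2
      simp only [p]
      field_simp
    have hpd : HasFDerivAt p (fderiv ℝ p z) z :=
      ((hp.contDiffAt (hN₃.mem_nhds hzN₃)).differentiableAt (by simp)).hasFDerivAt
    have h2 := ((hpd.mul hcd).neg.congr_of_eventuallyEq h1).fderiv
    have hpz0 : p z = 0 := by simp [p, haz]
    rw [h2, hpz0, hcz]
    simp
  -- This is dα = da ∧ dx + dc ∧ dy, the second derivatives of `x` and `y` being symmetric.
  have hdα : ∀ j k, fderiv ℝ α z j k - fderiv ℝ α z k j =
      fderiv ℝ a z j * l k - fderiv ℝ a z k * l j +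
        (fderiv ℝ c z j * α z k - fderiv ℝ c z k * α z j) := by
    have hsx : IsSymmSndFDerivAt ℝ x z :=
      (hx.contDiffAt (hN₁.mem_nhds hzN₁)).isSymmSndFDerivAt (by simpa using two_le_infty)
    have hsy : IsSymmSndFDerivAt ℝ y z :=
      (hy.contDiffAt (hN₁.mem_nhds hzN₁)).isSymmSndFDerivAt (by simpa using two_le_infty)
    have hxd : HasFDerivAt (fderiv ℝ x) (fderiv ℝ (fderiv ℝ x) z) z :=
      ((hx'.contDiffAt (hN₁.mem_nhds hzN₁)).differentiableAt (by simp)).hasFDerivAt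
    have hyd : HasFDerivAt (fderiv ℝ y) (fderiv ℝ (fderiv ℝ y) z) z :=
      ((hy'.contDiffAt (hN₁.mem_nhds hzN₁)).differentiableAt (by simp)).hasFDerivAt
    have h1 : α =ᶠ[𝓝 z] fun w => a w • fderiv ℝ x w + c w • fderiv ℝ y w :=
      Filter.eventually_of_mem (hN₂.mem_nhds hzN₂) hαac
    have h2 := (((had.smul hxd).add (hcd.smul hyd)).congr_of_eventuallyEq h1).fderiv
    intro j k
    have h3 := hsy.eq j k
    rw [h2]
    simp only [haz, hcz, hdxz, hdyz, add_apply, smul_apply, ContinuousLinearMap.smulRight_apply,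
      smul_eq_mul]
    rw [h3]
    ring
  -- At `z` one has α = dy and dp = -da, so α ∧ dα is dx ∧ dy ∧ dp up to sign, and a common zero of
  -- the three differentials would degenerate it. Injectivity then persists nearby.
  let D : E → E →L[ℝ] ℝ × ℝ × ℝ := fun w =>
    (fderiv ℝ x w).prod ((fderiv ℝ y w).prod (fderiv ℝ p w))
  have hDz : Function.Injective (D z) := by
    refine (injective_iff_map_eq_zero _).2 fun h h0 => ?_
    simp only [D, ContinuousLinearMap.prod_apply, hdxz, hdyz, hpz, Prod.mk_eq_zero, neg_apply,
      neg_eq_zero] at h0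
    obtain ⟨h1, h2, h3⟩ := h0
    obtain ⟨u, v, w, huvw⟩ := hcontact
    refine eq_zero_of_contact_degenerate hE huvw fun j k => ?_
    rw [hdα, hdα, hdα, h1, h2, h3]
    ring
  have hDc : ContinuousAt D z := by
    have h1 := (hx'.contDiffAt (hN₁.mem_nhds hzN₁)).continuousAt
    have h2 := (hy'.contDiffAt (hN₁.mem_nhds hzN₁)).continuousAt
    have h3 := (hp'.contDiffAt (hN₃.mem_nhds hzN₃)).continuousAt
    have h4 : ContinuousAt (fun w => ContinuousLinearMap.prodₗᵢ ℝ
      (fderiv ℝ x w, ContinuousLinearMap.prodₗᵢ ℝ (fderiv ℝ y w, fderiv ℝ p w))) z :=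
      (ContinuousLinearMap.prodₗᵢ ℝ).continuous.continuousAt.comp
        (h1.prodMk ((ContinuousLinearMap.prodₗᵢ ℝ).continuous.continuousAt.comp (h2.prodMk h3)))
    exact h4
  have hev := hDc.eventually (ContinuousLinearMap.isOpen_injective.mem_nhds hDz)
  obtain ⟨N₄, hN₄D, hN₄, hzN₄⟩ := mem_nhds_iff.1 hev
  refine ⟨x, y, p, N₃ ∩ N₄, hN₃.inter hN₄, ⟨hzN₃, hzN₄⟩, fun w hw => hU₁U (hN₁U (hN₃N₁ hw.1)),
    hx.mono fun w hw => hN₃N₁ hw.1, hy.mono fun w hw => hN₃N₁ hw.1, hp.mono fun w hw => hw.1,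
    by rwa [hdxz], ?_, ?_⟩
  · intro w hw h
    have hcw : c w ≠ 0 := hw.1.2
    have h1 : α w h = c w * (fderiv ℝ y w h - p w * fderiv ℝ x w h) := by
      rw [hαac w hw.1.1]
      simp only [add_apply, smul_apply, smul_eq_mul, p]
      field_simp
      ring
    rw [h1, mul_eq_zero, or_iff_right hcw, sub_eq_zero]
  · intro w hw h h1 h2 h3
    have := hN₄D hw.2
    exact (injective_iff_map_eq_zero (D w)).1 this h (by simp [D, h1, h2, h3])

end Darboux

/-! ### One-forms in charts -/

section FormsInCharts

variable {n : ℕ} {X : Type*} [TopologicalSpace X] [ChartedSpace (EuclideanSpace ℝ (Fin n)) X]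

/-- The expression of a one-form in the preferred chart at `p`. -/
def OneForm.inChart (θ : OneForm n X) (p : X) (z : EuclideanSpace ℝ (Fin n)) :
    EuclideanSpace ℝ (Fin n) →L[ℝ] ℝ :=
  (θ ((extChartAt (𝓡 n) p).symm z)).comp
    (mfderiv 𝓘(ℝ, EuclideanSpace ℝ (Fin n)) (𝓡 n) (extChartAt (𝓡 n) p).symm z)

theorem eventually_extChartAt_symm_mem {U : Set X} (hU : IsOpen U) {p : X} (hp : p ∈ U) :
    ∀ᶠ z in 𝓝 (extChartAt (𝓡 n) p p),
      z ∈ (extChartAt (𝓡 n) p).target ∧ (extChartAt (𝓡 n) p).symm z ∈ U := by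
  refine Filter.Eventually.and
    ((isOpen_extChartAt_target p).mem_nhds (mem_extChartAt_target p))
    ((continuousAt_extChartAt_symm p).eventually ?_)
  rw [(extChartAt (𝓡 n) p).left_inv (mem_extChartAt_source p)]
  exact hU.mem_nhds hp

theorem OneForm.d_congr {θ θ' : OneForm n X} {U : Set X} (hU : IsOpen U)
    (h : ∀ p ∈ U, θ p = θ' p) {p : X} (hp : p ∈ U) : θ.d p = θ'.d p := by
  funext v w
  unfold OneForm.d
  rw [Filter.EventuallyEq.extDeriv_eq]
  filter_upwards [eventually_extChartAt_symm_mem hU hp] with z hz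
  rw [h _ hz.2]

variable [IsManifold (𝓡 n) ∞ X]

theorem contMDiffAt_iff_comp_extChartAt_symm {F : Type*} [NormedAddCommGroup F] [NormedSpace ℝ F]
    {f : X → F} {p x : X} (hx : x ∈ (extChartAt (𝓡 n) p).source) :
    ContMDiffAt (𝓡 n) 𝓘(ℝ, F) ∞ f x ↔
      ContDiffAt ℝ ∞ (f ∘ (extChartAt (𝓡 n) p).symm) (extChartAt (𝓡 n) p x) := by
  have hs : ContMDiffAt 𝓘(ℝ, EuclideanSpace ℝ (Fin n)) (𝓡 n) ∞ (extChartAt (𝓡 n) p).symm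
      (extChartAt (𝓡 n) p x) :=
    (contMDiffOn_extChartAt_symm p).contMDiffAt
      ((isOpen_extChartAt_target p).mem_nhds ((extChartAt (𝓡 n) p).map_source hx))
  have he : ContMDiffAt (𝓡 n) 𝓘(ℝ, EuclideanSpace ℝ (Fin n)) ∞ (extChartAt (𝓡 n) p) x :=
    contMDiffAt_extChartAt' (by rwa [extChartAt_source] at hx)
  constructor
  · intro h
    rw [← contMDiffAt_iff_contDiffAt]
    refine ContMDiffAt.comp _ ?_ hs
    rwa [(extChartAt (𝓡 n) p).left_inv hx]
  · intro h
    have h2 := (contMDiffAt_iff_contDiffAt.2 h).comp x he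
    refine h2.congr_of_eventuallyEq ?_
    filter_upwards [(isOpen_extChartAt_source p).mem_nhds hx] with y hy
    rw [Function.comp_apply, Function.comp_apply, (extChartAt (𝓡 n) p).left_inv hy]

/-- The trivialisation of the cotangent bundle at `p` is precomposition with the derivative of the
inverse chart, which is what `inChart` records. -/
theorem contMDiffAt_section_iff_inChart {θ : OneForm n X} {p x : X}
    (hx : x ∈ (extChartAt (𝓡 n) p).source) :
    ContMDiffAt (𝓡 n) ((𝓡 n).prod 𝓘(ℝ, EuclideanSpace ℝ (Fin n) →L[ℝ] ℝ)) ∞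
      (fun p => Bundle.TotalSpace.mk' (EuclideanSpace ℝ (Fin n) →L[ℝ] ℝ)
        (E := fun p : X => TangentSpace (𝓡 n) p →L[ℝ] Bundle.Trivial X ℝ p) p (θ p)) x ↔
      ContDiffAt ℝ ∞ (θ.inChart p) (extChartAt (𝓡 n) p x) := by
  have hxc : x ∈ (chartAt (EuclideanSpace ℝ (Fin n)) p).source := by rwa [extChartAt_source] at hx
  rw [Bundle.Trivialization.contMDiffAt_section_iff
    (trivializationAt (EuclideanSpace ℝ (Fin n) →L[ℝ] ℝ)
      (fun p : X => TangentSpace (𝓡 n) p →L[ℝ] Bundle.Trivial X ℝ p) p) (by simpa using hxc),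
    contMDiffAt_iff_comp_extChartAt_symm hx]
  suffices key : (fun x : X => ((trivializationAt (EuclideanSpace ℝ (Fin n) →L[ℝ] ℝ)
      (fun p : X => TangentSpace (𝓡 n) p →L[ℝ] Bundle.Trivial X ℝ p) p) ⟨x, θ x⟩).2) ∘
      (extChartAt (𝓡 n) p).symm =ᶠ[𝓝 (extChartAt (𝓡 n) p x)] θ.inChart p by
    exact ⟨fun h => h.congr_of_eventuallyEq key.symm, fun h => h.congr_of_eventuallyEq key⟩
  filter_upwards [(isOpen_extChartAt_target p).mem_nhds ((extChartAt (𝓡 n) p).map_source hx)]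
    with z hz
  have hzc : (extChartAt (𝓡 n) p).symm z ∈ (chartAt (EuclideanSpace ℝ (Fin n)) p).source := by
    rw [← extChartAt_source (𝓡 n)]
    exact (extChartAt (𝓡 n) p).map_target hz
  have h1 := TangentBundle.symmL_trivializationAt (I := 𝓡 n) hzc
  rw [(extChartAt (𝓡 n) p).right_inv hz, ModelWithCorners.range_eq_univ, mfderivWithin_univ] at h1
  ext h
  simp only [Function.comp_apply, OneForm.inChart, hom_trivializationAt_apply,
    ContinuousLinearMap.inCoordinates]
  rw [h1]
  simp

theorem OneForm.smoothOn_iff {θ : OneForm n X} {U : Set X} (hU : IsOpen U) :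
    θ.SmoothOn U ↔ ∀ p ∈ U, ContDiffAt ℝ ∞ (θ.inChart p) (extChartAt (𝓡 n) p p) := by
  refine forall₂_congr fun p hp => ?_
  rw [← contMDiffAt_section_iff_inChart (mem_extChartAt_source p)]
  exact ⟨fun h => h.contMDiffAt (hU.mem_nhds hp), fun h => h.contMDiffWithinAt⟩

theorem OneForm.SmoothOn.contDiffOn_inChart {θ : OneForm n X} {U : Set X} (hU : IsOpen U)
    (h : θ.SmoothOn U) (p : X) : ContDiffOn ℝ ∞ (θ.inChart p)
      ((extChartAt (𝓡 n) p).target ∩ (extChartAt (𝓡 n) p).symm ⁻¹' U) := by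
  intro z hz
  have h1 := (contMDiffAt_section_iff_inChart ((extChartAt (𝓡 n) p).map_target hz.1)).1
    ((h _ hz.2).contMDiffAt (hU.mem_nhds hz.2))
  rw [(extChartAt (𝓡 n) p).right_inv hz.1] at h1
  exact h1.contDiffWithinAt

theorem dFun_inChart {f : X → ℝ} {p : X} {z : EuclideanSpace ℝ (Fin n)}
    (hz : z ∈ (extChartAt (𝓡 n) p).target)
    (hf : ContMDiffAt (𝓡 n) 𝓘(ℝ, ℝ) ∞ f ((extChartAt (𝓡 n) p).symm z)) :
    (dFun n f).inChart p z = fderiv ℝ (f ∘ (extChartAt (𝓡 n) p).symm) z := by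
  have hs : MDifferentiableAt 𝓘(ℝ, EuclideanSpace ℝ (Fin n)) (𝓡 n) (extChartAt (𝓡 n) p).symm z :=
    ((contMDiffOn_extChartAt_symm (n := ∞) p).contMDiffAt
      ((isOpen_extChartAt_target p).mem_nhds hz)).mdifferentiableAt (by simp)
  have h1 := mfderiv_comp z (hf.mdifferentiableAt (by simp)) hs
  rw [mfderiv_eq_fderiv] at h1
  rw [h1]
  rfl

/-- At its own base point the preferred chart has the identity as derivative, so the exterior
derivative is the antisymmetrised derivative of the local expression. -/
theorem OneForm.d_apply {θ : OneForm n X} {p : X}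
    (hθ : DifferentiableAt ℝ (θ.inChart p) (extChartAt (𝓡 n) p p))
    (v w : EuclideanSpace ℝ (Fin n)) :
    θ.d p v w = fderiv ℝ (θ.inChart p) (extChartAt (𝓡 n) p p) v w -
      fderiv ℝ (θ.inChart p) (extChartAt (𝓡 n) p p) w v := by
  set η := fun z => ContinuousAlternatingMap.ofSubsingleton ℝ
    (EuclideanSpace ℝ (Fin n)) ℝ (0 : Fin 1) (θ.inChart p z)
  let A := (ContinuousAlternatingMap.ofSubsingletonLIE (𝕜 := ℝ) (E := EuclideanSpace ℝ (Fin n))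
    (F := ℝ)
    (0 : Fin 1)).toContinuousLinearEquiv.toContinuousLinearMap
  have h1 : HasFDerivAt η (A.comp (fderiv ℝ (θ.inChart p) (extChartAt (𝓡 n) p p)))
      (extChartAt (𝓡 n) p p) := A.hasFDerivAt.comp _ hθ.hasFDerivAt
  have h2 : θ.d p v w = extDeriv η (extChartAt (𝓡 n) p p) ![v, w] := by
    unfold OneForm.d
    rw [mfderiv_extChartAt_self]
    rfl
  have h3 : ∀ (u : Fin 1 → EuclideanSpace ℝ (Fin n)) (k : EuclideanSpace ℝ (Fin n)),
      fderiv ℝ (fun z => η z u) (extChartAt (𝓡 n) p p) k =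
        fderiv ℝ (θ.inChart p) (extChartAt (𝓡 n) p p) k (u 0) := by
    intro u k
    have h4 : HasFDerivAt (fun z => η z u) _ (extChartAt (𝓡 n) p p) :=
      hθ.hasFDerivAt.clm_apply (hasFDerivAt_const (u 0) _)
    rw [h4.fderiv]
    simp
  rw [h2, extDeriv_apply h1.differentiableAt, Fin.sum_univ_two, h3, h3]
  simp [sub_eq_add_neg, Fin.removeNth]

theorem OneForm.inChart_self (θ : OneForm n X) (p : X) :
    θ.inChart p (extChartAt (𝓡 n) p p) = θ p := by
  have h1 := mfderivWithin_range_extChartAt_symm (I := 𝓡 n) (x := p)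
  rw [ModelWithCorners.range_eq_univ, mfderivWithin_univ] at h1
  let Θ : X → EuclideanSpace ℝ (Fin n) →L[ℝ] ℝ := θ
  unfold OneForm.inChart
  rw [h1]
  change Θ _ = Θ _
  rw [(extChartAt (𝓡 n) p).left_inv (mem_extChartAt_source p)]

theorem dFun_inChart_eventuallyEq {f : X → ℝ} {U : Set X} (hU : IsOpen U)
    (hf : ContMDiffOn (𝓡 n) 𝓘(ℝ, ℝ) ∞ f U) {p : X} (hp : p ∈ U) :
    (dFun n f).inChart p =ᶠ[𝓝 (extChartAt (𝓡 n) p p)]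
      fderiv ℝ (f ∘ (extChartAt (𝓡 n) p).symm) := by
  filter_upwards [eventually_extChartAt_symm_mem hU hp] with z hz
  exact dFun_inChart hz.1 (hf.contMDiffAt (hU.mem_nhds hz.2))

theorem ContMDiffOn.contDiffAt_inChart {f : X → ℝ} {U : Set X} (hU : IsOpen U)
    (hf : ContMDiffOn (𝓡 n) 𝓘(ℝ, ℝ) ∞ f U) {p : X} (hp : p ∈ U) :
    ContDiffAt ℝ ∞ (f ∘ (extChartAt (𝓡 n) p).symm) (extChartAt (𝓡 n) p p) :=
  (contMDiffAt_iff_comp_extChartAt_symm (mem_extChartAt_source p)).1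
    (hf.contMDiffAt (hU.mem_nhds hp))

theorem OneForm.smoothOn_dFun {f : X → ℝ} {U : Set X} (hU : IsOpen U)
    (hf : ContMDiffOn (𝓡 n) 𝓘(ℝ, ℝ) ∞ f U) : (dFun n f).SmoothOn U :=
  (OneForm.smoothOn_iff hU).2 fun p hp =>
    ((ContMDiffOn.contDiffAt_inChart hU hf hp).fderiv_right (by simp)).congr_of_eventuallyEq
      (dFun_inChart_eventuallyEq hU hf hp)

theorem OneForm.SmoothOn.neg {θ : OneForm n X} {U : Set X} (hU : IsOpen U) (h : θ.SmoothOn U) :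
    OneForm.SmoothOn (fun p => -θ p) U := by
  rw [OneForm.smoothOn_iff hU] at h ⊢
  exact fun p hp => (h p hp).neg

theorem OneForm.SmoothOn.sub_smul {θ θ' : OneForm n X} {g : X → ℝ} {U : Set X} (hU : IsOpen U)
    (h : θ.SmoothOn U) (h' : θ'.SmoothOn U) (hg : ContMDiffOn (𝓡 n) 𝓘(ℝ, ℝ) ∞ g U) :
    OneForm.SmoothOn (fun p => θ p - g p • θ' p) U := by
  rw [OneForm.smoothOn_iff hU] at h h' ⊢
  exact fun p hp => (h p hp).sub ((ContMDiffOn.contDiffAt_inChart hU hg hp).smul (h' p hp))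

theorem OneForm.SmoothOn.congr {θ θ' : OneForm n X} {U : Set X} (h : θ.SmoothOn U)
    (hθ : ∀ p ∈ U, θ' p = θ p) : θ'.SmoothOn U :=
  ContMDiffOn.congr h fun p hp => by rw [hθ p hp]

/-- Since df and dh are closed, only -dg ∧ dh = dh ∧ dg survives. -/
theorem OneForm.d_dFun_sub_smul_dFun {f g h : X → ℝ} {U : Set X} (hU : IsOpen U)
    (hf : ContMDiffOn (𝓡 n) 𝓘(ℝ, ℝ) ∞ f U) (hg : ContMDiffOn (𝓡 n) 𝓘(ℝ, ℝ) ∞ g U)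
    (hh : ContMDiffOn (𝓡 n) 𝓘(ℝ, ℝ) ∞ h U) {p : X} (hp : p ∈ U) :
    OneForm.d (fun p => dFun n f p - g p • dFun n h p) p = wedge (dFun n h p) (dFun n g p) := by
  have hf' := ContMDiffOn.contDiffAt_inChart hU hf hp
  have hg' := ContMDiffOn.contDiffAt_inChart hU hg hp
  have hh' := ContMDiffOn.contDiffAt_inChart hU hh hp
  have hdf := (hf'.fderiv_right (m := ∞) (by simp)).differentiableAt (by simp) |>.hasFDerivAt
  have hdh := (hh'.fderiv_right (m := ∞) (by simp)).differentiableAt (by simp) |>.hasFDerivAt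
  have hdg := (hg'.differentiableAt (by simp)).hasFDerivAt
  have key : OneForm.inChart (fun p => dFun n f p - g p • dFun n h p) p
      =ᶠ[𝓝 (extChartAt (𝓡 n) p p)] fun z => fderiv ℝ (f ∘ (extChartAt (𝓡 n) p).symm) z -
        (g ∘ (extChartAt (𝓡 n) p).symm) z • fderiv ℝ (h ∘ (extChartAt (𝓡 n) p).symm) z := by
    filter_upwards [dFun_inChart_eventuallyEq hU hf hp, dFun_inChart_eventuallyEq hU hh hp]
      with z h1 h2
    rw [← h1, ← h2]
    rfl
  have hd := (hdf.sub (hdg.smul hdh)).congr_of_eventuallyEq key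
  have hself : ∀ {k : X → ℝ}, ContMDiffOn (𝓡 n) 𝓘(ℝ, ℝ) ∞ k U →
      ∀ u, dFun n k p u =
        fderiv ℝ (k ∘ (extChartAt (𝓡 n) p).symm) (extChartAt (𝓡 n) p p) u := by
    intro k hk u
    rw [← (dFun_inChart_eventuallyEq hU hk hp).eq_of_nhds]
    exact (congrArg (fun A : EuclideanSpace ℝ (Fin n) →L[ℝ] ℝ => A u)
      (OneForm.inChart_self (dFun n k) p)).symm
  have hsf := hf'.isSymmSndFDerivAt (by simpa using two_le_infty)
  have hsh := hh'.isSymmSndFDerivAt (by simpa using two_le_infty)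
  have key2 : ∀ v w : EuclideanSpace ℝ (Fin n),
      OneForm.d (fun p => dFun n f p - g p • dFun n h p) p v w =
        fderiv ℝ (h ∘ (extChartAt (𝓡 n) p).symm) (extChartAt (𝓡 n) p p) v *
          fderiv ℝ (g ∘ (extChartAt (𝓡 n) p).symm) (extChartAt (𝓡 n) p p) w -
        fderiv ℝ (h ∘ (extChartAt (𝓡 n) p).symm) (extChartAt (𝓡 n) p p) w *
          fderiv ℝ (g ∘ (extChartAt (𝓡 n) p).symm) (extChartAt (𝓡 n) p p) v := by
    intro v w
    have h1 := hsf.eq v w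
    have h2 := hsh.eq v w
    rw [OneForm.d_apply hd.differentiableAt v w, hd.fderiv]
    simp only [sub_apply, add_apply, smul_apply, ContinuousLinearMap.smulRight_apply, smul_eq_mul]
    rw [h1, h2]
    ring
  funext v w
  refine (key2 v w).trans ?_
  unfold wedge
  rw [hself hh, hself hh, hself hg, hself hg]

theorem OneForm.SmoothOn.apply {θ : OneForm n X} {U : Set X} (h : θ.SmoothOn U)
    {v : ∀ y : X, TangentSpace (𝓡 n) y}
    (hv : ContMDiffOn (𝓡 n) (𝓡 n).tangent ∞ (fun y => (⟨y, v y⟩ : TangentBundle (𝓡 n) X)) U) :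
    ContMDiffOn (𝓡 n) 𝓘(ℝ, ℝ) ∞ (fun p => θ p (v p)) U := by
  have h1 : ContMDiffOn (𝓡 n) ((𝓡 n).prod 𝓘(ℝ, ℝ)) ∞
      (fun p => Bundle.TotalSpace.mk' ℝ (E := Bundle.Trivial X ℝ) p (θ p (v p))) U :=
    ContMDiffOn.clm_bundle_apply (F₁ := EuclideanSpace ℝ (Fin n))
      (E₁ := fun p : X => TangentSpace (𝓡 n) p) (F₂ := ℝ) (E₂ := Bundle.Trivial X ℝ) h hv
  intro p hp
  exact ((Bundle.contMDiffWithinAt_totalSpace).1 (h1 p hp)).2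

end FormsInCharts

/-! ### Covectors -/

section Covectors

variable {V : Type*} [AddCommGroup V] [Module ℝ V] [TopologicalSpace V]

theorem mem_span_range_of_ker_le {ι : Type*} [Finite ι] {η : ι → V →L[ℝ] ℝ} {ψ : V →L[ℝ] ℝ}
    (h : ∀ v, (∀ i, η i v = 0) → ψ v = 0) :
    ∃ c : ι →₀ ℝ, ∀ v, ψ v = c.sum fun i r => r * η i v := by
  have h1 : ψ.toLinearMap ∈ Submodule.span ℝ (Set.range fun i => (η i).toLinearMap) := by
    refine mem_span_of_iInf_ker_le_ker fun v hv => h v fun i => ?_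
    exact (Submodule.mem_iInf _).1 hv i
  obtain ⟨c, hc⟩ := Finsupp.mem_span_range_iff_exists_finsupp.1 h1
  refine ⟨c, fun v => ?_⟩
  have := congrArg (fun l : V →ₗ[ℝ] ℝ => l v) hc
  simpa [Finsupp.sum] using this.symm

end Covectors

/-! ### Contact coordinates on the base -/

section Base

variable {M : Type*} [TopologicalSpace M] [ChartedSpace (EuclideanSpace ℝ (Fin 3)) M]
  [IsManifold (𝓡 3) ∞ M]

/-- The contact coordinates are found in the chart at `m` and pulled back. The nonvanishing of dx on
`u` will let `x` parametrise the paths. -/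
theorem exists_contact_functions {D : TangentSubspaces 3 M} (hD : IsContactDistribution D) (m : M)
    {u : TangentSpace (𝓡 3) m} (hu : u ≠ 0) (huD : u ∈ D m) :
    ∃ (x y p : M → ℝ) (V : Set M), IsOpen V ∧ m ∈ V ∧
      ContMDiffOn (𝓡 3) 𝓘(ℝ, ℝ) ∞ x V ∧ ContMDiffOn (𝓡 3) 𝓘(ℝ, ℝ) ∞ y V ∧
      ContMDiffOn (𝓡 3) 𝓘(ℝ, ℝ) ∞ p V ∧ dFun 3 x m u ≠ 0 ∧
      (∀ a ∈ V, ∀ v, v ∈ D a ↔ dFun 3 y a v = p a * dFun 3 x a v) ∧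
      ∀ a ∈ V, ∀ v, dFun 3 x a v = 0 → dFun 3 y a v = 0 → dFun 3 p a v = 0 → v = 0 := by
  obtain ⟨W, hW, hmW, α, hα, hαD⟩ := hD m
  let e := extChartAt (𝓡 3) m
  have hme : m ∈ e.source := mem_extChartAt_source m
  let T : Set (EuclideanSpace ℝ (Fin 3)) := e.target ∩ e.symm ⁻¹' W
  have hT : IsOpen T := (continuousOn_extChartAt_symm m).isOpen_inter_preimage
    (isOpen_extChartAt_target m) hW
  have hαT : ContDiffOn ℝ ∞ (α.inChart m) T := hα.contDiffOn_inChart hW m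
  have hmT : e m ∈ T := ⟨e.map_source hme, by
    change e.symm (e m) ∈ W
    rwa [e.left_inv hme]⟩
  have hself : ∀ v : EuclideanSpace ℝ (Fin 3), α.inChart m (e m) v = α m v := fun v =>
    congrArg (fun A : EuclideanSpace ℝ (Fin 3) →L[ℝ] ℝ => A v) (OneForm.inChart_self α m)
  have hd : ∀ v w : EuclideanSpace ℝ (Fin 3), α.d m v w =
      fderiv ℝ (α.inChart m) (e m) v w - fderiv ℝ (α.inChart m) (e m) w v := fun v w =>
    OneForm.d_apply ((hαT.contDiffAt (hT.mem_nhds hmT)).differentiableAt (by simp)) v w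
  obtain ⟨hker, hcontact⟩ := hαD m hmW
  have key : ∀ a b c : EuclideanSpace ℝ (Fin 3),
      α m a * α.d m b c + α m b * α.d m c a + α m c * α.d m a b ≠ 0 →
      α.inChart m (e m) a *
          (fderiv ℝ (α.inChart m) (e m) b c - fderiv ℝ (α.inChart m) (e m) c b) +
        α.inChart m (e m) b *
          (fderiv ℝ (α.inChart m) (e m) c a - fderiv ℝ (α.inChart m) (e m) a c) +
        α.inChart m (e m) c *
          (fderiv ℝ (α.inChart m) (e m) a b - fderiv ℝ (α.inChart m) (e m) b a) ≠ 0 := by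
    intro a b c h
    rwa [← hd, ← hd, ← hd, hself, hself, hself]
  obtain ⟨x, y, p, N, hN, hmN, hNT, hx, hy, hp, hxu, hyp, hinj⟩ :=
    exists_contact_coordinates (by simp) hT hαT hmT
      (hcontact.imp fun a => Exists.imp fun b => Exists.imp fun c => key a b c)
      (u₀ := u) hu ((hself u).trans ((hker u).1 huD))
  let V : Set M := e.source ∩ e ⁻¹' N
  have hV : IsOpen V := (continuousOn_extChartAt m).isOpen_inter_preimage
    (isOpen_extChartAt_source m) hN
  have hdist : ∀ {f : EuclideanSpace ℝ (Fin 3) → ℝ}, ContDiffOn ℝ ∞ f N →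
      ContMDiffOn (𝓡 3) 𝓘(ℝ, ℝ) ∞ (fun a => f (e a)) V ∧
      ∀ a ∈ V, ∀ v, dFun 3 (fun a => f (e a)) a v =
        fderiv ℝ f (e a) (mfderiv (𝓡 3) 𝓘(ℝ, EuclideanSpace ℝ (Fin 3)) e a v) := by
    intro f hf
    have he : ContMDiffOn (𝓡 3) 𝓘(ℝ, EuclideanSpace ℝ (Fin 3)) ∞ e V :=
      (contMDiffOn_extChartAt (x := m)).mono fun a ha => by
        rw [← extChartAt_source (𝓡 3)]
        exact ha.1
    refine ⟨hf.contMDiffOn.comp he fun a ha => ha.2, fun a ha v => ?_⟩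
    have h1 : MDifferentiableAt 𝓘(ℝ, EuclideanSpace ℝ (Fin 3)) 𝓘(ℝ, ℝ) f (e a) :=
      ((hf.contDiffAt (hN.mem_nhds ha.2)).differentiableAt (by simp)).mdifferentiableAt
    have h2 := mfderiv_comp a h1 ((he.contMDiffAt (hV.mem_nhds ha)).mdifferentiableAt (by simp))
    rw [mfderiv_eq_fderiv] at h2
    exact congrArg (fun A : TangentSpace (𝓡 3) a →L[ℝ] ℝ => A v) h2
  obtain ⟨hx1, hx2⟩ := hdist hx
  obtain ⟨hy1, hy2⟩ := hdist hy
  obtain ⟨hp1, hp2⟩ := hdist hp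
  have hcomp : ∀ a ∈ V, ∀ v, mfderiv 𝓘(ℝ, EuclideanSpace ℝ (Fin 3)) (𝓡 3) e.symm (e a)
      (mfderiv (𝓡 3) 𝓘(ℝ, EuclideanSpace ℝ (Fin 3)) e a v) = v := by
    intro a ha v
    have h1 := mfderivWithin_extChartAt_symm_comp_mfderiv_extChartAt' (I := 𝓡 3) ha.1
    rw [ModelWithCorners.range_eq_univ, mfderivWithin_univ] at h1
    exact congrArg (fun A : EuclideanSpace ℝ (Fin 3) →L[ℝ] EuclideanSpace ℝ (Fin 3) => A v) h1
  refine ⟨fun a => x (e a), fun a => y (e a), fun a => p (e a), V, hV, ⟨hme, hmN⟩, hx1, hy1, hp1,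
    ?_, ?_, ?_⟩
  · rw [hx2 m ⟨hme, hmN⟩, mfderiv_extChartAt_self]
    exact hxu
  · intro a ha v
    rw [hy2 a ha, hx2 a ha]
    refine Iff.trans ?_ (hyp (e a) ha.2 _)
    have h1 : e.symm (e a) = a := e.left_inv ha.1
    have haW : a ∈ W := by
      have := (hNT ha.2).2
      change e.symm (e a) ∈ W at this
      rwa [h1] at this
    rw [(hαD a haW).1 v]
    have h2 : α.inChart m (e a) (mfderiv (𝓡 3) 𝓘(ℝ, EuclideanSpace ℝ (Fin 3)) e a v) = α a v := by
      let A : M → EuclideanSpace ℝ (Fin 3) →L[ℝ] ℝ := α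
      have h3 : α.inChart m (e a) (mfderiv (𝓡 3) 𝓘(ℝ, EuclideanSpace ℝ (Fin 3)) e a v) =
        A (e.symm (e a)) (mfderiv 𝓘(ℝ, EuclideanSpace ℝ (Fin 3)) (𝓡 3) e.symm (e a)
          (mfderiv (𝓡 3) 𝓘(ℝ, EuclideanSpace ℝ (Fin 3)) e a v)) := rfl
      rw [h3, h1]
      exact congrArg (A a) (hcomp a ha v)
    rw [h2]
  · intro a ha v h1 h2 h3
    have h4 := hinj (e a) ha.2 _ ((hx2 a ha v).symm.trans h1) ((hy2 a ha v).symm.trans h2)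
      ((hp2 a ha v).symm.trans h3)
    have h5 := hcomp a ha v
    rw [h4] at h5
    rw [← h5]
    exact map_zero _

end Base

/-! ### Coordinate functions adapted to a contact path geometry -/

section Adapted

variable {P M : Type*} [TopologicalSpace P] [ChartedSpace (EuclideanSpace ℝ (Fin 5)) P]
  [TopologicalSpace M] [ChartedSpace (EuclideanSpace ℝ (Fin 3)) M]
  [IsManifold (𝓡 5) ∞ P] [IsManifold (𝓡 3) ∞ M]

/-- The functions `x = f 0`, `yᵢ = f (i + 1)` on `U` are such that `dyᵢ - yᵢ₊₁ dx` vanishes on `L`,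
while `x, y₀, y₁` are coordinates of the base in which the contact distribution is the kernel of
`dy₀ - y₁ dx`. -/
structure IsAdapted (D : TangentSubspaces 3 M) (ρ : P → M) (L : TangentSubspaces 5 P) (U : Set P)
    (f : ℕ → P → ℝ) : Prop where
  isOpen : IsOpen U
  smooth : ∀ i, ContMDiffOn (𝓡 5) 𝓘(ℝ, ℝ) ∞ (f i) U
  line : ∀ p ∈ U, ∃ v, L p = Submodule.span ℝ {v} ∧ dFun 5 (f 0) p v ≠ 0 ∧
    ∀ i, dFun 5 (f (i + 1)) p v = f (i + 2) p * dFun 5 (f 0) p v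
  mem_vertical : ∀ p ∈ U, ∀ w, w ∈ vertical ρ p ↔
    dFun 5 (f 0) p w = 0 ∧ dFun 5 (f 1) p w = 0 ∧ dFun 5 (f 2) p w = 0
  base_surjective : ∀ p ∈ U, ∀ r s t : ℝ, ∃ w, dFun 5 (f 0) p w = r ∧ dFun 5 (f 1) p w = s ∧
    dFun 5 (f 2) p w = t
  contact : ∀ p ∈ U, ∀ w, mfderiv (𝓡 5) (𝓡 3) ρ p w ∈ D (ρ p) ↔
    dFun 5 (f 1) p w = f 2 p * dFun 5 (f 0) p w

/-- The functions obtained from `g` by repeatedly applying the vector field `v / dx(v)`. -/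
def iteratedDerivative (x : P → ℝ) (v : ∀ p : P, TangentSpace (𝓡 5) p) (g : P → ℝ) : ℕ → P → ℝ
  | 0 => g
  | k + 1 => fun p => dFun 5 (iteratedDerivative x v g k) p (v p) / dFun 5 x p (v p)

/-- The sequence `x, y, g, g', g'', …`. -/
def adaptedFunctions (x y : P → ℝ) (v : ∀ p : P, TangentSpace (𝓡 5) p) (g : P → ℝ) : ℕ → P → ℝ
  | 0 => x
  | 1 => y
  | k + 2 => iteratedDerivative x v g k

omit [IsManifold (𝓡 5) ∞ P] [IsManifold (𝓡 3) ∞ M] in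
theorem dFun_comp {x : M → ℝ} {ρ : P → M} {p : P}
    (hx : MDifferentiableAt (𝓡 3) 𝓘(ℝ, ℝ) x (ρ p)) (hρ : MDifferentiableAt (𝓡 5) (𝓡 3) ρ p)
    (w : TangentSpace (𝓡 5) p) :
    dFun 5 (fun p => x (ρ p)) p w = dFun 3 x (ρ p) (mfderiv (𝓡 5) (𝓡 3) ρ p w) :=
  congrArg (fun A : TangentSpace (𝓡 5) p →L[ℝ] ℝ => A w) (mfderiv_comp p hx hρ)

/-- Only the first relation dy₀ = y₁ dx on L uses the geometry: L projects into D. The later ones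
hold because each further function is by definition the derivative of the previous one along L with
respect to x. -/
theorem IsContactPathGeometry.exists_isAdapted {D : TangentSubspaces 3 M} {ρ : P → M}
    {L : TangentSubspaces 5 P} (h : IsContactPathGeometry D ρ L) (q : P) :
    ∃ (U : Set P) (f : ℕ → P → ℝ), q ∈ U ∧ IsAdapted D ρ L U f := by
  obtain ⟨U₀, hU₀, hqU₀, v, hv, hvL⟩ := h.lineField q
  have hvmem : ∀ p ∈ U₀, v p ∈ L p := fun p hp => by
    rw [(hvL p hp).2]
    exact Submodule.mem_span_singleton_self _
  have hρd : ∀ p, MDifferentiableAt (𝓡 5) (𝓡 3) ρ p := fun p =>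
    (h.smooth p).mdifferentiableAt (by simp)
  have hu : mfderiv (𝓡 5) (𝓡 3) ρ q (v q) ≠ 0 := by
    intro h0
    have h1 : v q ∈ L q ⊓ vertical ρ q := ⟨hvmem q hqU₀, h0⟩
    rw [h.transverse q] at h1
    exact (hvL q hqU₀).1 h1
  obtain ⟨x, y, g, V, hV, hqV, hx, hy, hg, hxu, hD, hinj⟩ :=
    exists_contact_functions h.contact (ρ q) hu (h.tangent_contact q _ (hvmem q hqU₀))
  let U₁ : Set P := U₀ ∩ ρ ⁻¹' V
  have hU₁ : IsOpen U₁ := hU₀.inter (hV.preimage h.smooth.continuous)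
  have hcomp : ∀ {k : M → ℝ}, ContMDiffOn (𝓡 3) 𝓘(ℝ, ℝ) ∞ k V →
      ContMDiffOn (𝓡 5) 𝓘(ℝ, ℝ) ∞ (fun p => k (ρ p)) U₁ ∧ ∀ p ∈ U₁, ∀ w,
        dFun 5 (fun p => k (ρ p)) p w = dFun 3 k (ρ p) (mfderiv (𝓡 5) (𝓡 3) ρ p w) :=
    fun hk => ⟨hk.comp h.smooth.contMDiffOn fun p hp => hp.2, fun p hp w =>
      dFun_comp ((hk.contMDiffAt (hV.mem_nhds hp.2)).mdifferentiableAt (by simp)) (hρd p) w⟩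
  obtain ⟨hx1, hx2⟩ := hcomp hx
  obtain ⟨hy1, hy2⟩ := hcomp hy
  obtain ⟨hg1, hg2⟩ := hcomp hg
  have hv₁ := hv.mono (Set.inter_subset_left : U₁ ⊆ U₀)
  have hxv : ContMDiffOn (𝓡 5) 𝓘(ℝ, ℝ) ∞ (fun p => dFun 5 (fun p => x (ρ p)) p (v p)) U₁ :=
    (OneForm.smoothOn_dFun hU₁ hx1).apply hv₁
  let U : Set P := U₁ ∩ (fun p => dFun 5 (fun p => x (ρ p)) p (v p)) ⁻¹' {0}ᶜ
  have hU : IsOpen U := hxv.continuousOn.isOpen_inter_preimage hU₁ isOpen_compl_singleton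
  have hUU₁ : U ⊆ U₁ := Set.inter_subset_left
  let f := adaptedFunctions (fun p => x (ρ p)) (fun p => y (ρ p)) v (fun p => g (ρ p))
  have hsmooth : ∀ i, ContMDiffOn (𝓡 5) 𝓘(ℝ, ℝ) ∞
      (iteratedDerivative (fun p => x (ρ p)) v (fun p => g (ρ p)) i) U := by
    intro i
    induction i with
    | zero => exact hg1.mono hUU₁
    | succ i ih =>
      exact ((OneForm.smoothOn_dFun hU ih).apply (hv₁.mono hUU₁)).div₀ (hxv.mono hUU₁)
        fun p hp => hp.2
  refine ⟨U, f, ⟨⟨hqU₀, hqV⟩, ?_⟩, hU, ?_, ?_, ?_, ?_, ?_⟩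
  · rw [Set.mem_preimage, hx2 q ⟨hqU₀, hqV⟩]
    exact hxu
  · rintro (_ | _ | i)
    exacts [hx1.mono hUU₁, hy1.mono hUU₁, hsmooth i]
  · intro p hp
    have hne : dFun 5 (fun p => x (ρ p)) p (v p) ≠ 0 := hp.2
    refine ⟨v p, (hvL p hp.1.1).2, hne, ?_⟩
    rintro (_ | i)
    · have h1 := (hD (ρ p) hp.1.2 _).1 (h.tangent_contact p _ (hvmem p hp.1.1))
      rw [← hy2 p hp.1, ← hx2 p hp.1] at h1
      exact h1
    · exact (div_mul_cancel₀ _ hne).symm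
  · intro p hp w
    change _ ↔ dFun 5 (fun p => x (ρ p)) p w = 0 ∧ dFun 5 (fun p => y (ρ p)) p w = 0 ∧
      dFun 5 (fun p => g (ρ p)) p w = 0
    rw [hx2 p hp.1, hy2 p hp.1, hg2 p hp.1]
    constructor
    · intro hw
      have hw0 : mfderiv (𝓡 5) (𝓡 3) ρ p w = 0 := hw
      simp [hw0]
    · rintro ⟨h1, h2, h3⟩
      exact hinj _ hp.1.2 _ h1 h2 h3
  · intro p hp r s t
    let A : EuclideanSpace ℝ (Fin 3) →L[ℝ] ℝ × ℝ × ℝ :=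
      (dFun 3 x (ρ p)).prod ((dFun 3 y (ρ p)).prod (dFun 3 g (ρ p)))
    have hA : Function.Injective A := by
      refine (injective_iff_map_eq_zero _).2 fun w hw => ?_
      have h1 := congrArg Prod.fst hw
      have h2 := congrArg (fun z => z.2.1) hw
      have h3 := congrArg (fun z => z.2.2) hw
      exact hinj _ hp.1.2 w h1 h2 h3
    have hA' : Function.Surjective A.toLinearMap :=
      (LinearMap.injective_iff_surjective_of_finrank_eq_finrank (by simp)).1 hA
    obtain ⟨u, hu⟩ := hA' (r, s, t)
    obtain ⟨w, rfl⟩ := h.submersion p u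
    refine ⟨w, ?_, ?_, ?_⟩
    · exact (hx2 p hp.1 w).trans (congrArg Prod.fst hu)
    · exact (hy2 p hp.1 w).trans (congrArg (fun z => z.2.1) hu)
    · exact (hg2 p hp.1 w).trans (congrArg (fun z => z.2.2) hu)
  · intro p hp w
    change _ ↔ dFun 5 (fun p => y (ρ p)) p w = g (ρ p) * dFun 5 (fun p => x (ρ p)) p w
    rw [hx2 p hp.1, hy2 p hp.1]
    exact hD (ρ p) hp.1.2 _

end Adapted

/-! ### The Pfaffian systems in adapted functions -/

section Ideal

variable {V : Type*} [AddCommGroup V] [Module ℝ V] [TopologicalSpace V]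

theorem CongrMod.of_eq {W : Submodule ℝ (V →L[ℝ] ℝ)} {A B : V → V → ℝ} (h : A = B) :
    CongrMod W A B := by
  rw [CongrMod, h, sub_self]
  exact Submodule.zero_mem _

/-- Converts dx ∧ θ into θ ∧ σ for σ = -dx. -/
theorem wedge_eq_wedge_neg (α β : V →L[ℝ] ℝ) : wedge α β = wedge β (-α) := by
  funext v w
  simp only [wedge, neg_apply]
  ring

theorem CongrMod.of_eq_wedge {W : Submodule ℝ (V →L[ℝ] ℝ)} {A : V → V → ℝ} {α β : V →L[ℝ] ℝ}
    (hα : α ∈ W) (h : A = wedge α β) : CongrMod W A 0 := by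
  rw [CongrMod, sub_zero]
  exact Submodule.subset_span ⟨α, hα, β, h⟩

theorem mem_span_pair_of_ker_le {η₀ η₁ ψ : V →L[ℝ] ℝ}
    (h : ∀ v, η₀ v = 0 → η₁ v = 0 → ψ v = 0) : ψ ∈ Submodule.span ℝ {η₀, η₁} := by
  obtain ⟨c, hc⟩ := mem_span_range_of_ker_le (η := ![η₀, η₁]) (ψ := ψ)
    (fun v hv => h v (hv 0) (hv 1))
  refine Submodule.mem_span_pair.2 ⟨c 0, c 1, ContinuousLinearMap.ext fun v => ?_⟩
  rw [hc v, Finsupp.sum_fintype _ _ (by simp), Fin.sum_univ_two]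
  simp

theorem mem_span_triple_of_ker_le {η₀ η₁ η₂ ψ : V →L[ℝ] ℝ}
    (h : ∀ v, η₀ v = 0 → η₁ v = 0 → η₂ v = 0 → ψ v = 0) : ψ ∈ Submodule.span ℝ {η₀, η₁, η₂} := by
  obtain ⟨c, hc⟩ := mem_span_range_of_ker_le (η := ![η₀, η₁, η₂]) (ψ := ψ)
    (fun v hv => h v (hv 0) (hv 1) (hv 2))
  refine Submodule.mem_span_triple.2 ⟨c 0, c 1, c 2, ContinuousLinearMap.ext fun v => ?_⟩
  rw [hc v, Finsupp.sum_fintype _ _ (by simp), Fin.sum_univ_three]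
  simp

theorem mem_span_quadruple_of_ker_le {η₀ η₁ η₂ η₃ ψ : V →L[ℝ] ℝ}
    (h : ∀ v, η₀ v = 0 → η₁ v = 0 → η₂ v = 0 → η₃ v = 0 → ψ v = 0) :
    ψ ∈ Submodule.span ℝ {η₀, η₁, η₂, η₃} := by
  obtain ⟨c, hc⟩ := mem_span_range_of_ker_le (η := ![η₀, η₁, η₂, η₃]) (ψ := ψ)
    (fun v hv => h v (hv 0) (hv 1) (hv 2) (hv 3))
  have hψ : ψ = c 0 • η₀ + c 1 • η₁ + c 2 • η₂ + c 3 • η₃ := by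
    refine ContinuousLinearMap.ext fun v => ?_
    rw [hc v, Finsupp.sum_fintype _ _ (by simp), Fin.sum_univ_four]
    simp
  rw [hψ]
  have hmem : ∀ η ∈ ({η₀, η₁, η₂, η₃} : Set (V →L[ℝ] ℝ)), ∀ r : ℝ,
      r • η ∈ Submodule.span ℝ {η₀, η₁, η₂, η₃} := fun η hη r =>
    Submodule.smul_mem _ _ (Submodule.subset_span hη)
  exact add_mem (add_mem (add_mem (hmem _ (by simp) _) (hmem _ (by simp) _)) (hmem _ (by simp) _))
    (hmem _ (by simp) _)

theorem exists_smul_eq_of_finrank_submodule_eq_one {S : Submodule ℝ (V →L[ℝ] ℝ)}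
    (hS : Module.finrank ℝ S = 1) {α β : V →L[ℝ] ℝ} (hα : α ∈ S) (hβ : β ∈ S) (h : α ≠ 0) :
    ∃ c : ℝ, c • α = β := by
  have hne : (⟨α, hα⟩ : S) ≠ 0 := fun h0 => h (congrArg Subtype.val h0)
  obtain ⟨c, hc⟩ := exists_smul_eq_of_finrank_eq_one (K := ℝ) (V := S) hS hne ⟨β, hβ⟩
  exact ⟨c, congrArg Subtype.val hc⟩

end Ideal

/-! ### Sections of a system of rank two -/

section Sections

variable {n : ℕ} {X : Type*} [TopologicalSpace X] [ChartedSpace (EuclideanSpace ℝ (Fin n)) X]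
  [IsManifold (𝓡 n) ∞ X]

/-- Contractions of the exterior derivative of a section of a system spanned by two forms. -/
theorem OneForm.d_apply_of_mem_span_pair {θ θ₀ θ₁ : OneForm n X} {U : Set X} (hU : IsOpen U)
    (hθ : θ.SmoothOn U) (hθ₀ : θ₀.SmoothOn U) (hθ₁ : θ₁.SmoothOn U)
    (hspan : ∀ y ∈ U, θ y ∈ Submodule.span ℝ {θ₀ y, θ₁ y}) {p : X} (hp : p ∈ U)
    {w₀ w₁ : EuclideanSpace ℝ (Fin n)} (hw : θ₀ p w₀ * θ₁ p w₁ - θ₀ p w₁ * θ₁ p w₀ ≠ 0)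
    {v : EuclideanSpace ℝ (Fin n)} (hv₀ : θ₀ p v = 0) (hv₁ : θ₁ p v = 0) :
    ∃ a b c d : ℝ, ∀ w, θ.d p v w =
      a * θ₀ p w + b * θ₁ p w + c * θ₀.d p v w + d * θ₁.d p v w := by
  let E := EuclideanSpace ℝ (Fin n)
  let e := extChartAt (𝓡 n) p p
  have hdiff : ∀ {η : OneForm n X}, η.SmoothOn U → ∀ w : E,
      DifferentiableAt ℝ (η.inChart p) e ∧ DifferentiableAt ℝ (fun z => η.inChart p z w) e := by
    intro η hη w
    have h1 := ((OneForm.smoothOn_iff hU).1 hη p hp).differentiableAt (by simp)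
    exact ⟨h1, h1.clm_apply (differentiableAt_const w)⟩
  have hself : ∀ (η : OneForm n X) (w : E), η.inChart p e w = η p w := fun η w =>
    congrArg (fun A : E →L[ℝ] ℝ => A w) (OneForm.inChart_self η p)
  -- Cramer's rule on `w₀`, `w₁` shows that the coefficients of `θ` in terms of `θ₀`, `θ₁` are
  -- differentiable near `p`.
  let δ : E → ℝ := fun z => θ₀.inChart p z w₀ * θ₁.inChart p z w₁ -
    θ₀.inChart p z w₁ * θ₁.inChart p z w₀
  let a : E → ℝ := fun z => (θ.inChart p z w₀ * θ₁.inChart p z w₁ -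
    θ.inChart p z w₁ * θ₁.inChart p z w₀) * (δ z)⁻¹
  let b : E → ℝ := fun z => (θ₀.inChart p z w₀ * θ.inChart p z w₁ -
    θ₀.inChart p z w₁ * θ.inChart p z w₀) * (δ z)⁻¹
  have hδ : DifferentiableAt ℝ δ e :=
    ((hdiff hθ₀ w₀).2.mul (hdiff hθ₁ w₁).2).sub ((hdiff hθ₀ w₁).2.mul (hdiff hθ₁ w₀).2)
  have hδ0 : δ e ≠ 0 := by
    have h1 : δ e = θ₀ p w₀ * θ₁ p w₁ - θ₀ p w₁ * θ₁ p w₀ := by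
      change θ₀.inChart p e w₀ * θ₁.inChart p e w₁ - θ₀.inChart p e w₁ * θ₁.inChart p e w₀ = _
      rw [hself, hself, hself, hself]
    rw [h1]
    exact hw
  have ha : DifferentiableAt ℝ a e :=
    (((hdiff hθ w₀).2.mul (hdiff hθ₁ w₁).2).sub ((hdiff hθ w₁).2.mul (hdiff hθ₁ w₀).2)).mul
      (hδ.inv hδ0)
  have hb : DifferentiableAt ℝ b e :=
    (((hdiff hθ₀ w₀).2.mul (hdiff hθ w₁).2).sub ((hdiff hθ₀ w₁).2.mul (hdiff hθ w₀).2)).mul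
      (hδ.inv hδ0)
  have hev : θ.inChart p =ᶠ[𝓝 e] fun z => a z • θ₀.inChart p z + b z • θ₁.inChart p z := by
    filter_upwards [eventually_extChartAt_symm_mem hU hp, hδ.continuousAt.eventually_ne hδ0]
      with z hz hz0
    obtain ⟨r, s, hrs⟩ := Submodule.mem_span_pair.1 (hspan _ hz.2)
    have h1 : ∀ w : E, θ.inChart p z w = r * θ₀.inChart p z w + s * θ₁.inChart p z w := by
      intro w
      change θ _ _ = r * θ₀ _ _ + s * θ₁ _ _
      rw [← hrs]
      rfl
    have hr : a z = r := by
      refine (mul_inv_eq_iff_eq_mul₀ hz0).2 ?_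
      rw [h1, h1]
      simp only [δ]
      ring
    have hs : b z = s := by
      refine (mul_inv_eq_iff_eq_mul₀ hz0).2 ?_
      rw [h1, h1]
      simp only [δ]
      ring
    refine ContinuousLinearMap.ext fun w => ?_
    rw [hr, hs, h1]
    rfl
  have hd := ((ha.hasFDerivAt.smul (hdiff hθ₀ w₀).1.hasFDerivAt).add
    (hb.hasFDerivAt.smul (hdiff hθ₁ w₀).1.hasFDerivAt)).congr_of_eventuallyEq hev
  -- Contract dθ = da ∧ θ₀ + db ∧ θ₁ + a dθ₀ + b dθ₁ with `v`, which `θ₀` and `θ₁` kill.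
  have key : ∀ v w : E, θ₀ p v = 0 → θ₁ p v = 0 → θ.d p v w =
      fderiv ℝ a e v * θ₀ p w + fderiv ℝ b e v * θ₁ p w + a e * θ₀.d p v w +
        b e * θ₁.d p v w := by
    intro v w h0 h1
    rw [← hself] at h0 h1
    have hw0 := hself θ₀ w
    have hw1 := hself θ₁ w
    rw [OneForm.d_apply (hdiff hθ w₀).1 v w, OneForm.d_apply (hdiff hθ₀ w₀).1 v w,
      OneForm.d_apply (hdiff hθ₁ w₀).1 v w, hd.fderiv, ← hw0, ← hw1]
    simp only [add_apply, smul_apply, ContinuousLinearMap.smulRight_apply, smul_eq_mul]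
    rw [h0, h1]
    ring
  exact ⟨fderiv ℝ a e v, fderiv ℝ b e v, a e, b e, fun w => key v w hv₀ hv₁⟩

end Sections

/-! ### Jet forms and their independence -/

section Adapted

variable {P M : Type*} [TopologicalSpace P] [ChartedSpace (EuclideanSpace ℝ (Fin 5)) P]
  [TopologicalSpace M] [ChartedSpace (EuclideanSpace ℝ (Fin 3)) M]

/-- The form `dyᵢ - yᵢ₊₁ dx`, where `x = f 0`, `yᵢ = f (i + 1)`. -/
def jetForm (f : ℕ → P → ℝ) (i : ℕ) : OneForm 5 P :=
  fun p => dFun 5 (f (i + 1)) p - f (i + 2) p • dFun 5 (f 0) p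

theorem jetForm_apply (f : ℕ → P → ℝ) (i : ℕ) (p : P) (w : TangentSpace (𝓡 5) p) :
    jetForm f i p w = dFun 5 (f (i + 1)) p w - f (i + 2) p * dFun 5 (f 0) p w := rfl

variable [IsManifold (𝓡 5) ∞ P]

namespace IsAdapted

variable {D : TangentSubspaces 3 M} {ρ : P → M} {L : TangentSubspaces 5 P} {U : Set P}
  {f : ℕ → P → ℝ} (hf : IsAdapted D ρ L U f)

include hf

theorem smoothOn_jetForm (i : ℕ) : (jetForm f i).SmoothOn U :=
  (OneForm.smoothOn_dFun hf.isOpen (hf.smooth _)).sub_smul hf.isOpen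
    (OneForm.smoothOn_dFun hf.isOpen (hf.smooth _)) (hf.smooth _)

/-- The exterior derivative is dx ∧ dyᵢ₊₁, and subtracting a multiple of dx from the second factor
changes nothing. -/
theorem d_jetForm (i : ℕ) {p : P} (hp : p ∈ U) :
    (jetForm f i).d p = wedge (dFun 5 (f 0) p) (jetForm f (i + 1) p) := by
  refine (OneForm.d_dFun_sub_smul_dFun hf.isOpen (hf.smooth _) (hf.smooth _) (hf.smooth _)
    hp).trans ?_
  funext v w
  simp only [wedge, jetForm_apply]
  ring

omit [IsManifold (𝓡 5) ∞ P] in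
theorem exists_line {p : P} (hp : p ∈ U) : ∃ v, L p = Submodule.span ℝ {v} ∧
    dFun 5 (f 0) p v ≠ 0 ∧ ∀ i, jetForm f i p v = 0 := by
  obtain ⟨v, h1, h2, h3⟩ := hf.line p hp
  exact ⟨v, h1, h2, fun i => by rw [jetForm_apply, h3, sub_self]⟩

omit [IsManifold (𝓡 5) ∞ P] in
theorem exists_dual {p : P} (hp : p ∈ U) (r s t : ℝ) : ∃ w, dFun 5 (f 0) p w = r ∧
    jetForm f 0 p w = s ∧ jetForm f 1 p w = t := by
  obtain ⟨w, h1, h2, h3⟩ := hf.base_surjective p hp r (s + f 2 p * r) (t + f 3 p * r)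
  refine ⟨w, h1, ?_, ?_⟩
  · rw [jetForm_apply, h1, h2]
    ring
  · rw [jetForm_apply, h1, h3]
    ring

omit [IsManifold (𝓡 5) ∞ P] hf in
theorem mem_annihilator_of_span_singleton {p : P} {v : TangentSpace (𝓡 5) p}
    (hv : L p = Submodule.span ℝ {v}) {ψ : TangentSpace (𝓡 5) p →L[ℝ] ℝ} :
    ψ ∈ annihilator (L p) ↔ ψ v = 0 := by
  constructor
  · intro h
    exact h v (by rw [hv]; exact Submodule.mem_span_singleton_self v)
  · intro h w hw
    rw [hv] at hw
    obtain ⟨c, rfl⟩ := Submodule.mem_span_singleton.1 hw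
    rw [map_smul, h, smul_zero]

omit [IsManifold (𝓡 5) ∞ P] in
-- A vector killed by θ₀ and θ₁ becomes vertical after subtracting the multiple of the generator of
-- L with the same value of dx: once dx vanishes, θᵢ is dyᵢ.
theorem systemI_eq {p : P} (hp : p ∈ U) :
    systemI ρ L p = Submodule.span ℝ {jetForm f 0 p, jetForm f 1 p} := by
  obtain ⟨v, hv, hxv, hjv⟩ := hf.exists_line hp
  apply le_antisymm
  · intro ψ hψ
    have hψL : ∀ w ∈ L p, ψ w = 0 := fun w hw => hψ w (Submodule.mem_sup_left hw)
    have hψv : ψ v = 0 := hψL v (by rw [hv]; exact Submodule.mem_span_singleton_self v)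
    refine mem_span_pair_of_ker_le fun w h0 h1 => ?_
    set c := dFun 5 (f 0) p w / dFun 5 (f 0) p v with hc
    have hx : dFun 5 (f 0) p (w - c • v) = 0 := by
      rw [map_sub, map_smul, smul_eq_mul, hc, div_mul_cancel₀ _ hxv, sub_self]
    have hj : ∀ i, jetForm f i p w = 0 → dFun 5 (f (i + 1)) p (w - c • v) = 0 := by
      intro i hi
      have h2 : jetForm f i p (w - c • v) = 0 := by rw [map_sub, map_smul, hi, hjv]; simp
      rw [jetForm_apply, hx, mul_zero, sub_zero] at h2
      exact h2
    have h3 : w - c • v ∈ vertical ρ p := (hf.mem_vertical p hp _).2 ⟨hx, hj 0 h0, hj 1 h1⟩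
    have h4 := hψ _ (Submodule.mem_sup_right h3)
    rw [map_sub, map_smul, hψv, smul_zero, sub_zero] at h4
    exact h4
  · rw [Submodule.span_le]
    have key : ∀ i, (∀ w ∈ vertical ρ p, jetForm f i p w = 0) →
        jetForm f i p ∈ systemI ρ L p := by
      intro i hi w hw
      obtain ⟨a, ha, b, hb, rfl⟩ := Submodule.mem_sup.1 hw
      rw [hv] at ha
      obtain ⟨c, rfl⟩ := Submodule.mem_span_singleton.1 ha
      rw [map_add, map_smul, hjv, hi b hb, smul_zero, add_zero]
    rintro ψ (rfl | rfl)
    · refine key 0 fun w hw => ?_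
      obtain ⟨h0, h1, h2⟩ := (hf.mem_vertical p hp w).1 hw
      rw [jetForm_apply, h0, h1, mul_zero, sub_zero]
    · refine key 1 fun w hw => ?_
      obtain ⟨h0, h1, h2⟩ := (hf.mem_vertical p hp w).1 hw
      rw [jetForm_apply, h0, h2, mul_zero, sub_zero]

omit [IsManifold (𝓡 5) ∞ P] in
theorem jetForm_mem_systemI {p : P} (hp : p ∈ U) :
    jetForm f 0 p ∈ systemI ρ L p ∧ jetForm f 1 p ∈ systemI ρ L p := by
  rw [hf.systemI_eq hp]
  exact ⟨Submodule.subset_span (by simp), Submodule.subset_span (by simp)⟩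

theorem congrMod_d_jetForm (i : ℕ) {p : P} (hp : p ∈ U)
    {W : Submodule ℝ (TangentSpace (𝓡 5) p →L[ℝ] ℝ)} (h : jetForm f (i + 1) p ∈ W) :
    CongrMod W ((jetForm f i).d p) 0 := by
  refine CongrMod.of_eq_wedge (β := -dFun 5 (f 0) p) h ?_
  rw [hf.d_jetForm i hp]
  funext v w
  simp only [wedge, neg_apply]
  ring

/-- θᵢ must lie in `S` on all of `U`, but θᵢ₊₁ only at `p`, since the congruence is tested at that
point. This is why the contradictions below work at each single point. -/
theorem jetForm_mem_derivedSystem (i : ℕ) {S : PfaffianSystem 5 P}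
    (hS : ∀ p ∈ U, jetForm f i p ∈ S p) {p : P} (hp : p ∈ U) (h : jetForm f (i + 1) p ∈ S p) :
    jetForm f i p ∈ derivedSystem S p :=
  Submodule.subset_span ⟨jetForm f i, ⟨U, hf.isOpen, hp, hf.smoothOn_jetForm i, hS⟩,
    hf.congrMod_d_jetForm i hp h, rfl⟩

/-- Otherwise θ₀ and θ₁, which are independent, would both lie in the one-dimensional I' at `p`. -/
theorem jetForm_two_notMem (h : ∀ p, Module.finrank ℝ (derivedSystem (systemI ρ L) p) = 1) {p : P}
    (hp : p ∈ U) : jetForm f 2 p ∉ systemI ρ L p := by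
  intro h2
  have h0' := hf.jetForm_mem_derivedSystem 0 (S := systemI ρ L)
    (fun p hp => (hf.jetForm_mem_systemI hp).1) hp (hf.jetForm_mem_systemI hp).2
  have h1' := hf.jetForm_mem_derivedSystem 1 (S := systemI ρ L)
    (fun p hp => (hf.jetForm_mem_systemI hp).2) hp h2
  obtain ⟨w₀, -, hw0, hw1⟩ := hf.exists_dual hp 0 1 0
  obtain ⟨w₁, -, hu0, hu1⟩ := hf.exists_dual hp 0 0 1
  have hne : jetForm f 0 p ≠ 0 := by
    intro h0
    rw [h0] at hw0
    exact zero_ne_one hw0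
  obtain ⟨c, hc⟩ := exists_smul_eq_of_finrank_submodule_eq_one (h p) h0' h1' hne
  have h3 := congrArg (fun ψ : TangentSpace (𝓡 5) p →L[ℝ] ℝ => ψ w₁) hc
  simp [hu0, hu1] at h3

/-- For a Cauchy characteristic `w`, the contraction of dθ₁ = dx ∧ θ₂ with `w` lies in I, hence
kills the generator `v` of L. As θ₂(v) = 0, its value there is -dx(v) θ₂(w), so θ₂(w) = 0. -/
theorem jetForm_mem_systemJ {p : P} (hp : p ∈ U) :
    jetForm f 0 p ∈ systemJ ρ L p ∧ jetForm f 1 p ∈ systemJ ρ L p ∧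
      jetForm f 2 p ∈ systemJ ρ L p := by
  obtain ⟨v, hv, hxv, hjv⟩ := hf.exists_line hp
  have hL : ∀ i, jetForm f i p ∈ annihilator (L p) := fun i =>
    (mem_annihilator_of_span_singleton hv).2 (hjv i)
  have hR : ∀ ψ : TangentSpace (𝓡 5) p →L[ℝ] ℝ,
      (∀ w, IsCauchyCharacteristic (systemI ρ L) p w → ψ w = 0) →
      ψ ∈ retractingSpace (systemI ρ L) p := by
    intro ψ hψ w hw
    induction hw using Submodule.span_induction with
    | mem w hw => exact hψ w hw
    | zero => exact map_zero ψ
    | add a b _ _ ha hb => rw [map_add, ha, hb, add_zero]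
    | smul c a _ ha => rw [map_smul, ha, smul_zero]
  refine ⟨⟨hR _ fun w hw => hw.1 _ (hf.jetForm_mem_systemI hp).1, hL 0⟩,
    ⟨hR _ fun w hw => hw.1 _ (hf.jetForm_mem_systemI hp).2, hL 1⟩, ⟨hR _ fun w hw => ?_, hL 2⟩⟩
  obtain ⟨ψ, hψ, hd⟩ := hw.2 (jetForm f 1) ⟨U, hf.isOpen, hp, hf.smoothOn_jetForm 1,
    fun y hy => (hf.jetForm_mem_systemI hy).2⟩
  have h1 := hd v
  have h2 : ψ v = 0 := hψ v (Submodule.mem_sup_left (by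
    rw [hv]; exact Submodule.mem_span_singleton_self v))
  rw [hf.d_jetForm 1 hp, h2, wedge, hjv, mul_zero, zero_sub, neg_eq_zero] at h1
  exact (mul_eq_zero.1 h1).resolve_left hxv

/-- Otherwise θ₂ would lie in J' = I at `p`. -/
theorem jetForm_three_notMem (h : ∀ p, Module.finrank ℝ (derivedSystem (systemI ρ L) p) = 1)
    (h' : ∀ p, derivedSystem (systemJ ρ L) p = systemI ρ L p) {p : P} (hp : p ∈ U) :
    jetForm f 3 p ∉ Submodule.span ℝ {jetForm f 0 p, jetForm f 1 p, jetForm f 2 p} := by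
  intro h3
  have h4 : jetForm f 3 p ∈ systemJ ρ L p := by
    refine Submodule.span_le.2 ?_ h3
    rintro ψ (rfl | rfl | rfl)
    exacts [(hf.jetForm_mem_systemJ hp).1, (hf.jetForm_mem_systemJ hp).2.1,
      (hf.jetForm_mem_systemJ hp).2.2]
  have h5 := hf.jetForm_mem_derivedSystem 2 (fun p hp => (hf.jetForm_mem_systemJ hp).2.2) hp h4
  rw [h'] at h5
  exact hf.jetForm_two_notMem h hp h5

theorem linearIndependent (h : ∀ p, Module.finrank ℝ (derivedSystem (systemI ρ L) p) = 1)
    (h' : ∀ p, derivedSystem (systemJ ρ L) p = systemI ρ L p) {p : P} (hp : p ∈ U) :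
    LinearIndependent ℝ ![-dFun 5 (f 0) p, jetForm f 0 p, jetForm f 1 p, jetForm f 2 p,
      jetForm f 3 p] := by
  obtain ⟨v, hv, hxv, hjv⟩ := hf.exists_line hp
  rw [Fintype.linearIndependent_iff]
  intro c hc
  rw [Fin.sum_univ_five] at hc
  have hc' : ∀ w, -(c 0 * dFun 5 (f 0) p w) + c 1 * jetForm f 0 p w + c 2 * jetForm f 1 p w +
      c 3 * jetForm f 2 p w + c 4 * jetForm f 3 p w = 0 := by
    intro w
    have := congrArg (fun ψ : TangentSpace (𝓡 5) p →L[ℝ] ℝ => ψ w) hc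
    simpa using this
  -- The generator of L kills every jet form but not dx. After that the coefficients fall from the
  -- top down.
  have h0 : c 0 = 0 := by
    have := hc' v
    simp only [hjv, mul_zero, add_zero, neg_eq_zero] at this
    exact (mul_eq_zero.1 this).resolve_right hxv
  have h4 : c 4 = 0 := by
    by_contra h4
    refine hf.jetForm_three_notMem h h' hp (mem_span_triple_of_ker_le fun w h1 h2 h3 => ?_)
    have := hc' w
    simp only [h0, h1, h2, h3, mul_zero, zero_mul, neg_zero, zero_add] at this
    exact (mul_eq_zero.1 this).resolve_left h4
  have h3 : c 3 = 0 := by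
    by_contra h3
    refine hf.jetForm_two_notMem h hp ?_
    rw [hf.systemI_eq hp]
    refine mem_span_pair_of_ker_le fun w h1 h2 => ?_
    have := hc' w
    simp only [h0, h1, h2, h4, mul_zero, zero_mul, neg_zero, zero_add, add_zero] at this
    exact (mul_eq_zero.1 this).resolve_left h3
  obtain ⟨w₀, hx0, hw0, hw1⟩ := hf.exists_dual hp 0 1 0
  obtain ⟨w₁, hx1, hu0, hu1⟩ := hf.exists_dual hp 0 0 1
  have h1 : c 1 = 0 := by
    have := hc' w₀
    simpa [h0, h3, h4, hw0, hw1] using this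
  have h2 : c 2 = 0 := by
    have := hc' w₁
    simpa [h0, h3, h4, hu0, hu1] using this
  intro i
  fin_cases i <;> assumption

end IsAdapted

end Adapted

/-! ### The adapted coframe of adapted functions -/

/-- Linearly independent covectors, as many as the dimension, have no common zero. -/
theorem eq_zero_of_linearIndependent {E : Type*} [NormedAddCommGroup E] [NormedSpace ℝ E]
    [FiniteDimensional ℝ E] {ι : Type*} [Fintype ι] {η : ι → E →L[ℝ] ℝ}
    (hη : LinearIndependent ℝ η) (hcard : Fintype.card ι = Module.finrank ℝ E) {w : E}
    (hw : ∀ i, η i w = 0) : w = 0 := by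
  by_contra hne
  have hdim : Module.finrank ℝ (E →L[ℝ] ℝ) = Module.finrank ℝ E := by
    rw [(LinearMap.toContinuousLinearMap (𝕜 := ℝ) (E := E) (F' := ℝ)).symm.finrank_eq]
    exact Subspace.dual_finrank_eq
  obtain ⟨φ, hφ⟩ := SeparatingDual.exists_eq_one (R := ℝ) hne
  have h0 : ∀ φ ∈ Submodule.span ℝ (Set.range η), φ w = 0 := by
    intro φ hmem
    induction hmem using Submodule.span_induction with
    | mem φ hφ => obtain ⟨i, rfl⟩ := hφ; exact hw i
    | zero => rfl
    | add a b _ _ ha hb => rw [add_apply, ha, hb, add_zero]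
    | smul c a _ ha => rw [smul_apply, ha, smul_zero]
  rw [hη.span_eq_top_of_card_eq_finrank' (hcard.trans hdim.symm)] at h0
  exact zero_ne_one ((h0 φ Submodule.mem_top).symm.trans hφ)

section Adapted

variable {P M : Type*} [TopologicalSpace P] [ChartedSpace (EuclideanSpace ℝ (Fin 5)) P]
  [TopologicalSpace M] [ChartedSpace (EuclideanSpace ℝ (Fin 3)) M] [IsManifold (𝓡 5) ∞ P]

theorem IsZeroAdapted.congr {D : TangentSubspaces 3 M} {ρ : P → M} {L : TangentSubspaces 5 P}
    {U V : Set P} {σ σ' : OneForm 5 P} {θ θ' : Fin 4 → OneForm 5 P}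
    (h : IsZeroAdapted D ρ L U σ θ) (hV : IsOpen V) (hVU : V ⊆ U)
    (hσ : ∀ p ∈ V, σ' p = σ p) (hθ : ∀ i, ∀ p ∈ V, θ' i p = θ i p) :
    IsZeroAdapted D ρ L V σ' θ' where
  smooth_sigma := OneForm.SmoothOn.congr (ContMDiffOn.mono h.smooth_sigma hVU) hσ
  smooth_theta i := OneForm.SmoothOn.congr (ContMDiffOn.mono (h.smooth_theta i) hVU) (hθ i)
  coframe p hp := by
    rw [hσ p hp, hθ 0 p hp, hθ 1 p hp, hθ 2 p hp, hθ 3 p hp]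
    exact h.coframe p (hVU hp)
  contact p hp := by
    rw [hθ 0 p hp]
    exact h.contact p (hVU hp)
  span_I p hp := by
    rw [hθ 0 p hp, hθ 1 p hp]
    exact h.span_I p (hVU hp)
  span_J p hp := by
    rw [hθ 0 p hp, hθ 1 p hp, hθ 2 p hp]
    exact h.span_J p (hVU hp)
  span_L p hp := by
    rw [hθ 0 p hp, hθ 1 p hp, hθ 2 p hp, hθ 3 p hp]
    exact h.span_L p (hVU hp)
  structure_zero p hp := by
    rw [OneForm.d_congr hV (hθ 0) hp, hσ p hp, hθ 0 p hp, hθ 1 p hp]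
    exact h.structure_zero p (hVU hp)
  structure_one p hp := by
    rw [OneForm.d_congr hV (hθ 1) hp, hσ p hp, hθ 0 p hp, hθ 1 p hp, hθ 2 p hp]
    exact h.structure_one p (hVU hp)
  structure_two p hp := by
    rw [OneForm.d_congr hV (hθ 2) hp, hσ p hp, hθ 0 p hp, hθ 1 p hp, hθ 2 p hp, hθ 3 p hp]
    exact h.structure_two p (hVU hp)

namespace IsAdapted

variable {D : TangentSubspaces 3 M} {ρ : P → M} {L : TangentSubspaces 5 P} {U : Set P}
  {f : ℕ → P → ℝ} (hf : IsAdapted D ρ L U f)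

include hf

/-- Vectors on which `dx` and the first three jet forms vanish are Cauchy characteristic. -/
theorem isCauchyCharacteristic {p : P} (hp : p ∈ U) {w : EuclideanSpace ℝ (Fin 5)}
    (hx : dFun 5 (f 0) p w = 0) (h0 : jetForm f 0 p w = 0) (h1 : jetForm f 1 p w = 0)
    (h2 : jetForm f 2 p w = 0) : IsCauchyCharacteristic (systemI ρ L) p w := by
  constructor
  · intro φ hφ
    rw [hf.systemI_eq hp] at hφ
    obtain ⟨a, b, rfl⟩ := Submodule.mem_span_pair.1 hφ
    change a * jetForm f 0 p w + b * jetForm f 1 p w = 0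
    rw [h0, h1, mul_zero, mul_zero, add_zero]
  · rintro θ ⟨V, hV, hpV, hθ, hθI⟩
    obtain ⟨w₀, -, hw0, hw1⟩ := hf.exists_dual hp 0 1 0
    obtain ⟨w₁, -, hu0, hu1⟩ := hf.exists_dual hp 0 0 1
    obtain ⟨a, b, c, d, key⟩ := OneForm.d_apply_of_mem_span_pair (θ₀ := jetForm f 0)
      (θ₁ := jetForm f 1) (hf.isOpen.inter hV) (ContMDiffOn.mono hθ Set.inter_subset_right)
      (ContMDiffOn.mono (hf.smoothOn_jetForm 0) Set.inter_subset_left)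
      (ContMDiffOn.mono (hf.smoothOn_jetForm 1) Set.inter_subset_left)
      (fun y hy => by rw [← hf.systemI_eq hy.1]; exact hθI y hy.2) ⟨hp, hpV⟩
      (w₀ := w₀) (w₁ := w₁)
      (by
        have : jetForm f 0 p w₀ * jetForm f 1 p w₁ - jetForm f 0 p w₁ * jetForm f 1 p w₀ = 1 := by
          rw [hw0, hu1, hu0]
          ring
        exact this ▸ one_ne_zero) h0 h1
    refine ⟨a • jetForm f 0 p + b • jetForm f 1 p, add_mem
      (Submodule.smul_mem _ _ (hf.jetForm_mem_systemI hp).1)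
      (Submodule.smul_mem _ _ (hf.jetForm_mem_systemI hp).2), fun u => ?_⟩
    -- dθᵢ = dx ∧ θᵢ₊₁, and both factors vanish on `w`.
    have hd : ∀ i, jetForm f (i + 1) p w = 0 → (jetForm f i).d p w u = 0 := by
      intro i hi
      rw [hf.d_jetForm i hp]
      change dFun 5 (f 0) p w * _ - dFun 5 (f 0) p u * jetForm f (i + 1) p w = 0
      rw [hx, hi, zero_mul, mul_zero, sub_zero]
    refine (key u).trans ?_
    rw [hd 0 h1, hd 1 h2, mul_zero, mul_zero, add_zero, add_zero]
    rfl

/-- A vector killed by θ₀, θ₁, θ₂ becomes Cauchy characteristic once its dx-component is removed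
along L, and a form in J kills both L and the Cauchy characteristic vectors. -/
theorem systemJ_eq {p : P} (hp : p ∈ U) :
    systemJ ρ L p = Submodule.span ℝ {jetForm f 0 p, jetForm f 1 p, jetForm f 2 p} := by
  obtain ⟨v, hv, hxv, hjv⟩ := hf.exists_line hp
  apply le_antisymm
  · rintro ψ ⟨hψ, hψL⟩
    have hψv : ψ v = 0 := (mem_annihilator_of_span_singleton hv).1 hψL
    refine mem_span_triple_of_ker_le fun w h0 h1 h2 => ?_
    set c := dFun 5 (f 0) p w / dFun 5 (f 0) p v with hc
    have hx : dFun 5 (f 0) p (w - c • v) = 0 := by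
      rw [map_sub, map_smul, smul_eq_mul, hc, div_mul_cancel₀ _ hxv, sub_self]
    have hj : ∀ i, jetForm f i p w = 0 → jetForm f i p (w - c • v) = 0 := by
      intro i hi
      rw [map_sub, map_smul, hi, hjv]
      simp
    have h4 : ψ (w - c • v) = 0 := hψ _ (Submodule.subset_span
      (hf.isCauchyCharacteristic hp hx (hj 0 h0) (hj 1 h1) (hj 2 h2)))
    rw [map_sub, map_smul, hψv, smul_zero, sub_zero] at h4
    exact h4
  · rw [Submodule.span_le]
    rintro ψ (rfl | rfl | rfl)
    exacts [(hf.jetForm_mem_systemJ hp).1, (hf.jetForm_mem_systemJ hp).2.1,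
      (hf.jetForm_mem_systemJ hp).2.2]

theorem eq_zero_of_apply_eq_zero [IsManifold (𝓡 3) ∞ M] (h : IsContactPathGeometry D ρ L) {p : P}
    (hp : p ∈ U) {w : EuclideanSpace ℝ (Fin 5)} (hx : dFun 5 (f 0) p w = 0)
    (hj : ∀ i < 4, jetForm f i p w = 0) : w = 0 := by
  refine eq_zero_of_linearIndependent (E := EuclideanSpace ℝ (Fin 5))
    (hf.linearIndependent h.derived_I h.derived_J hp) (by simp) fun i => ?_
  fin_cases i
  exacts [neg_eq_zero.2 hx, hj 0 (by simp), hj 1 (by simp), hj 2 (by simp), hj 3 (by simp)]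

theorem mem_line_iff [IsManifold (𝓡 3) ∞ M] (h : IsContactPathGeometry D ρ L) {p : P}
    (hp : p ∈ U) {w : TangentSpace (𝓡 5) p} :
    w ∈ L p ↔ ∀ i < 4, jetForm f i p w = 0 := by
  obtain ⟨v, hv, hxv, hjv⟩ := hf.exists_line hp
  rw [hv]
  constructor
  · intro hw i _
    obtain ⟨c, rfl⟩ := Submodule.mem_span_singleton.1 hw
    rw [map_smul, hjv, smul_zero]
  · intro hj
    set c := dFun 5 (f 0) p w / dFun 5 (f 0) p v with hc
    have hw : w - c • v = 0 := by
      refine hf.eq_zero_of_apply_eq_zero h hp ?_ fun i hi => ?_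
      · rw [map_sub, map_smul, smul_eq_mul, hc, div_mul_cancel₀ _ hxv, sub_self]
      · rw [map_sub, map_smul, hjv, smul_zero, sub_zero, hj i hi]
    rw [sub_eq_zero.1 hw]
    exact Submodule.smul_mem _ _ (Submodule.mem_span_singleton_self v)

theorem annihilator_line_eq [IsManifold (𝓡 3) ∞ M] (h : IsContactPathGeometry D ρ L) {p : P}
    (hp : p ∈ U) : annihilator (L p) =
      Submodule.span ℝ {jetForm f 0 p, jetForm f 1 p, jetForm f 2 p, jetForm f 3 p} := by
  apply le_antisymm
  · intro ψ hψ
    refine mem_span_quadruple_of_ker_le fun w h0 h1 h2 h3 =>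
      hψ w ((hf.mem_line_iff h hp).2 fun i hi => ?_)
    interval_cases i <;> assumption
  · rw [Submodule.span_le]
    rintro ψ (rfl | rfl | rfl | rfl) w hw
    exacts [(hf.mem_line_iff h hp).1 hw 0 (by simp), (hf.mem_line_iff h hp).1 hw 1 (by simp),
      (hf.mem_line_iff h hp).1 hw 2 (by simp), (hf.mem_line_iff h hp).1 hw 3 (by simp)]

theorem isZeroAdapted [IsManifold (𝓡 3) ∞ M] (h : IsContactPathGeometry D ρ L) :
    IsZeroAdapted D ρ L U (fun p => -dFun 5 (f 0) p)
      ![jetForm f 0, jetForm f 1, jetForm f 2, jetForm f 3] where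
  smooth_sigma := (OneForm.smoothOn_dFun hf.isOpen (hf.smooth 0)).neg hf.isOpen
  smooth_theta i := by fin_cases i <;> exact hf.smoothOn_jetForm _
  coframe p hp := hf.linearIndependent h.derived_I h.derived_J hp
  contact p hp w := (hf.contact p hp w).trans sub_eq_zero.symm
  span_I p hp := hf.systemI_eq hp
  span_J p hp := hf.systemJ_eq hp
  span_L p hp := hf.annihilator_line_eq h hp
  structure_zero p hp := CongrMod.of_eq ((hf.d_jetForm 0 hp).trans (wedge_eq_wedge_neg _ _))
  structure_one p hp := CongrMod.of_eq ((hf.d_jetForm 1 hp).trans (wedge_eq_wedge_neg _ _))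
  structure_two p hp := CongrMod.of_eq ((hf.d_jetForm 2 hp).trans (wedge_eq_wedge_neg _ _))

end IsAdapted

end Adapted

/-! ### Charts with prescribed coordinate functions -/

section Charts

variable {n : ℕ} {X : Type*} [TopologicalSpace X] [ChartedSpace (EuclideanSpace ℝ (Fin n)) X]

theorem dFun_congr {f g : X → ℝ} {U : Set X} (hU : IsOpen U) (h : ∀ p ∈ U, f p = g p) {p : X}
    (hp : p ∈ U) : dFun n f p = dFun n g p :=
  Filter.EventuallyEq.mfderiv_eq (Filter.eventuallyEq_of_mem (hU.mem_nhds hp) h)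

variable [IsManifold (𝓡 n) ∞ X]

/-- Functions with independent differentials at `q` are the coordinates of a chart at `q`. -/
theorem exists_chart_of_dFun {f : Fin n → X → ℝ} {U : Set X} (hU : IsOpen U)
    (hf : ∀ i, ContMDiffOn (𝓡 n) 𝓘(ℝ, ℝ) ∞ (f i) U) {q : X} (hq : q ∈ U)
    (hinj : ∀ w, (∀ i, dFun n (f i) q w = 0) → w = 0) :
    ∃ φ ∈ IsManifold.maximalAtlas (𝓡 n) ∞ X, q ∈ φ.source ∧ φ.source ⊆ U ∧
      ∀ p ∈ φ.source, ∀ i, φ p i = f i p := by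
  let E := EuclideanSpace ℝ (Fin n)
  let e := extChartAt (𝓡 n) q
  let Y : X → E := fun p => WithLp.toLp 2 fun i => f i p
  have hY : ContMDiffOn (𝓡 n) 𝓘(ℝ, E) ∞ Y U := by
    intro p hp
    have h1 : ContMDiffWithinAt (𝓡 n) 𝓘(ℝ, Fin n → ℝ) ∞ (fun p i => f i p) U p :=
      contMDiffWithinAt_pi_space.2 fun i => hf i p hp
    exact ((PiLp.contDiff_toLp (p := 2)).contMDiff.contMDiffAt).comp_contMDiffWithinAt p h1
  let W : Set E := e.target ∩ e.symm ⁻¹' U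
  have hW : IsOpen W := (continuousOn_extChartAt_symm q).isOpen_inter_preimage
    (isOpen_extChartAt_target q) hU
  have hG : ContDiffOn ℝ ∞ (Y ∘ e.symm) W := by
    intro z hz
    have h1 := (contMDiffAt_iff_comp_extChartAt_symm (e.map_target hz.1)).1
      ((hY _ hz.2).contMDiffAt (hU.mem_nhds hz.2))
    rw [e.right_inv hz.1] at h1
    exact h1.contDiffWithinAt
  have haW : e q ∈ W := by
    refine ⟨mem_extChartAt_target q, ?_⟩
    rw [Set.mem_preimage, e.left_inv (mem_extChartAt_source q)]
    exact hq
  have hGa : DifferentiableAt ℝ (Y ∘ e.symm) (e q) :=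
    (hG.contDiffAt (hW.mem_nhds haW)).differentiableAt (by simp)
  have hG' : Function.Injective (fderiv ℝ (Y ∘ e.symm) (e q)) := by
    refine (injective_iff_map_eq_zero _).2 fun w hw => hinj w fun i => ?_
    have h1 : HasFDerivAt (f i ∘ e.symm) _ (e q) :=
      (EuclideanSpace.proj (𝕜 := ℝ) i).hasFDerivAt.comp (e q) hGa.hasFDerivAt
    have h2 : (dFun n (f i)).inChart q (e q) = _ :=
      (dFun_inChart_eventuallyEq hU (hf i) hq).eq_of_nhds
    rw [OneForm.inChart_self] at h2
    have h3 : dFun n (f i) q w = fderiv ℝ (f i ∘ e.symm) (e q) w :=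
      congrArg (fun A : E →L[ℝ] ℝ => A w) h2
    rw [h3, h1.fderiv]
    change EuclideanSpace.proj (𝕜 := ℝ) i (fderiv ℝ (Y ∘ e.symm) (e q) w) = 0
    rw [hw, map_zero]
  -- Injectivity suffices, the dimensions being equal.
  let A : E ≃L[ℝ] E := (LinearEquiv.ofInjectiveEndo
    (fderiv ℝ (Y ∘ e.symm) (e q)).toLinearMap hG').toContinuousLinearEquiv
  obtain ⟨ψ, hψ, hψW, hψG, hψs⟩ := exists_localDiffeomorph hW hG haW (f' := A)
    (hGa.hasFDerivAt.congr_fderiv (ContinuousLinearMap.ext fun w => rfl))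
  let φ : OpenPartialHomeomorph X E := (chartAt E q).trans ψ
  have hφe : ∀ p ∈ φ.source, p ∈ e.source ∧ e p ∈ ψ.source := by
    intro p hp
    rw [OpenPartialHomeomorph.trans_source] at hp
    exact ⟨by rw [extChartAt_source]; exact hp.1, hp.2⟩
  have hφU : φ.source ⊆ U := by
    intro p hp
    have h1 := (hψW (hφe p hp).2).2
    rw [Set.mem_preimage, e.left_inv (hφe p hp).1] at h1
    exact h1
  have hφY : ∀ p ∈ φ.source, φ p = Y p := by
    intro p hp
    change ψ (e p) = Y p
    rw [hψG, Function.comp_apply, e.left_inv (hφe p hp).1]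
  refine ⟨φ, ?_, ?_, hφU, fun p hp i => by rw [hφY p hp]⟩
  · rw [IsManifold.mem_maximalAtlas_iff_contMDiffOn]
    refine ⟨(hY.mono hφU).congr hφY, ?_⟩
    refine (contMDiffOn_chart_symm (I := 𝓡 n) (x := q)).comp
      (hψs.contMDiffOn.mono fun z hz => ?_) fun z hz => ?_
    · rw [OpenPartialHomeomorph.trans_target] at hz
      exact hz.1
    · rw [OpenPartialHomeomorph.trans_target] at hz
      exact hz.2
  · rw [OpenPartialHomeomorph.trans_source]
    exact ⟨mem_chart_source E q, hψ⟩

end Charts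


/-! ### Curves and solutions of ordinary differential equations -/

section Curves

theorem contDiffOn_iteratedDeriv {y : ℝ → ℝ} {s : Set ℝ} (hs : IsOpen s) (hy : ContDiffOn ℝ ∞ y s)
    (k : ℕ) : ContDiffOn ℝ ∞ (iteratedDeriv k y) s := by
  induction k with
  | zero => rwa [iteratedDeriv_zero]
  | succ k ih =>
    rw [iteratedDeriv_succ]
    exact ih.deriv_of_isOpen hs (by simp)

/-- Rolle's theorem. -/
theorem injOn_of_deriv_ne_zero {x : ℝ → ℝ} {s : Set ℝ} (hs : s.OrdConnected)
    (hx : ContinuousOn x s) (hx' : ∀ t ∈ s, deriv x t ≠ 0) : s.InjOn x := by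
  have key : ∀ a ∈ s, ∀ b ∈ s, a < b → x a ≠ x b := by
    intro a ha b hb hab h
    obtain ⟨c, hc, hc'⟩ := exists_deriv_eq_zero hab (hx.mono (hs.out ha hb)) h
    exact hx' c (hs.out ha hb (Set.Ioo_subset_Icc_self hc)) hc'
  intro a ha b hb h
  by_contra hne
  rcases lt_or_gt_of_ne hne with hab | hab
  · exact key a ha b hb hab h
  · exact key b hb a ha hab h.symm

/-- A function with nowhere vanishing derivative on an open interval has a smooth inverse, defined
on an open interval. -/
theorem exists_smooth_inverse {x : ℝ → ℝ} {s : Set ℝ} (hs : IsOpen s) (hs' : s.OrdConnected)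
    (hx : ContDiffOn ℝ ∞ x s) (hx' : ∀ t ∈ s, deriv x t ≠ 0) :
    IsOpen (x '' s) ∧ (x '' s).OrdConnected ∧ ∃ τ : ℝ → ℝ, ContDiffOn ℝ ∞ τ (x '' s) ∧
      ∀ t ∈ s, τ (x t) = t := by
  have hinj := injOn_of_deriv_ne_zero hs' hx.continuousOn hx'
  have hloc : ∀ t ∈ s, ∃ e : OpenPartialHomeomorph ℝ ℝ, t ∈ e.source ∧ e.source ⊆ s ∧
      (∀ z, e z = x z) ∧ ContDiffOn ℝ ∞ e.symm e.target := fun t ht =>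
    exists_localDiffeomorph hs hx ht (((hx.contDiffAt (hs.mem_nhds ht)).differentiableAt
      (by simp)).hasDerivAt.hasFDerivAt_equiv (hx' t ht))
  have hsub : ∀ e : OpenPartialHomeomorph ℝ ℝ, e.source ⊆ s → (∀ z, e z = x z) →
      e.target ⊆ x '' s := fun e h1 h2 z hz =>
    ⟨e.symm z, h1 (e.map_target hz), by rw [← h2, e.right_inv hz]⟩
  have hleft : ∀ t ∈ s, Function.invFunOn x s (x t) = t := fun t ht =>
    hinj.leftInvOn_invFunOn ht
  refine ⟨isOpen_iff_mem_nhds.2 ?_, (hs'.isPreconnected.image x hx.continuousOn).ordConnected,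
    Function.invFunOn x s, ?_, hleft⟩
  · rintro _ ⟨t, ht, rfl⟩
    obtain ⟨e, h1, h2, h3, -⟩ := hloc t ht
    refine Filter.mem_of_superset (e.open_target.mem_nhds ?_) (hsub e h2 h3)
    rw [← h3]
    exact e.map_source h1
  · rintro _ ⟨t, ht, rfl⟩
    obtain ⟨e, h1, h2, h3, h4⟩ := hloc t ht
    have hmem : e.target ∈ 𝓝 (x t) := by
      refine e.open_target.mem_nhds ?_
      rw [← h3]
      exact e.map_source h1
    -- The set-theoretic inverse agrees near `x t` with the smooth local inverse, by injectivity of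
    -- `x`.
    refine ((h4.contDiffAt hmem).congr_of_eventuallyEq ?_).contDiffWithinAt
    filter_upwards [hmem] with z hz
    have h5 := hleft _ (h2 (e.map_target hz))
    rwa [← h3, e.right_inv hz] at h5

/-- If `Yₖ' = Yₖ₊₁ x'` along a curve, then `Yₖ` is the `k`-th derivative of `Y₀` as a function
of `x`. -/
theorem iteratedDeriv_comp_inverse {x τ : ℝ → ℝ} {Y : ℕ → ℝ → ℝ} {s : Set ℝ} (hs : IsOpen s)
    (hs' : IsOpen (x '' s)) (hx : ∀ t ∈ s, DifferentiableAt ℝ x t)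
    (hY : ∀ k, ∀ t ∈ s, HasDerivAt (Y k) (Y (k + 1) t * deriv x t) t)
    (hτ : ∀ z ∈ x '' s, DifferentiableAt ℝ τ z) (hτx : ∀ t ∈ s, τ (x t) = t) (k : ℕ) :
    ∀ t ∈ s, iteratedDeriv k (Y 0 ∘ τ) (x t) = Y k t := by
  induction k with
  | zero =>
    intro t ht
    rw [iteratedDeriv_zero, Function.comp_apply, hτx t ht]
  | succ k ih =>
    intro t ht
    have hev : iteratedDeriv k (Y 0 ∘ τ) =ᶠ[𝓝 (x t)] Y k ∘ τ := by
      filter_upwards [hs'.mem_nhds (Set.mem_image_of_mem x ht)] with z hz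
      obtain ⟨u, hu, rfl⟩ := hz
      rw [ih u hu, Function.comp_apply, hτx u hu]
    have h1 : HasDerivAt τ (deriv τ (x t)) (x t) := (hτ _ (Set.mem_image_of_mem x ht)).hasDerivAt
    have h2 : HasDerivAt (τ ∘ x) (deriv τ (x t) * deriv x t) t :=
      h1.comp t (hx t ht).hasDerivAt
    have h3 : τ ∘ x =ᶠ[𝓝 t] id := Filter.eventuallyEq_of_mem (hs.mem_nhds ht) hτx
    have h4 : deriv τ (x t) * deriv x t = 1 :=
      h2.unique ((hasDerivAt_id t).congr_of_eventuallyEq h3)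
    have h5 : HasDerivAt (Y k ∘ τ) (Y (k + 1) t * deriv x t * deriv τ (x t)) (x t) := by
      refine HasDerivAt.comp (x t) ?_ h1
      rw [hτx t ht]
      exact hY k t ht
    rw [iteratedDeriv_succ, hev.deriv_eq, h5.deriv, mul_assoc, mul_comm (deriv x t), h4, mul_one]

end Curves

section Paths

variable {n : ℕ} {X : Type*} [TopologicalSpace X] [ChartedSpace (EuclideanSpace ℝ (Fin n)) X]
  [IsManifold (𝓡 n) ∞ X]

omit [IsManifold (𝓡 n) ∞ X] in
theorem hasDerivAt_comp_curve {g : X → ℝ} {U : Set X} (hU : IsOpen U)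
    (hg : ContMDiffOn (𝓡 n) 𝓘(ℝ, ℝ) ∞ g U) {γ : ℝ → X} {s : Set ℝ} (hs : IsOpen s)
    (hγ : ContMDiffOn 𝓘(ℝ, ℝ) (𝓡 n) ∞ γ s) {t : ℝ} (ht : t ∈ s) (htU : γ t ∈ U) :
    HasDerivAt (fun t => g (γ t)) (dFun n g (γ t) (mfderiv 𝓘(ℝ, ℝ) (𝓡 n) γ t (1 : ℝ))) t := by
  have hγt : ContMDiffAt 𝓘(ℝ, ℝ) (𝓡 n) ∞ γ t := hγ.contMDiffAt (hs.mem_nhds ht)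
  have hgt : ContMDiffAt (𝓡 n) 𝓘(ℝ, ℝ) ∞ g (γ t) := hg.contMDiffAt (hU.mem_nhds htU)
  have h1 : DifferentiableAt ℝ (g ∘ γ) t :=
    (contMDiffAt_iff_contDiffAt.1 (hgt.comp t hγt)).differentiableAt (by simp)
  have h2 := mfderiv_comp t (hgt.mdifferentiableAt (by simp)) (hγt.mdifferentiableAt (by simp))
  rw [mfderiv_eq_fderiv] at h2
  have h3 : deriv (g ∘ γ) t = dFun n g (γ t) (mfderiv 𝓘(ℝ, ℝ) (𝓡 n) γ t (1 : ℝ)) :=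
    congrArg (fun A : ℝ →L[ℝ] ℝ => A 1) h2
  rw [← h3]
  exact h1.hasDerivAt

end Paths

/-! ### Paths and solutions in the adapted chart -/

section Adapted

variable {P M : Type*} [TopologicalSpace P] [ChartedSpace (EuclideanSpace ℝ (Fin 5)) P]
  [TopologicalSpace M] [ChartedSpace (EuclideanSpace ℝ (Fin 3)) M] [IsManifold (𝓡 5) ∞ P]
  [IsManifold (𝓡 3) ∞ M]

namespace IsAdapted

variable {D : TangentSubspaces 3 M} {ρ : P → M} {L : TangentSubspaces 5 P} {U : Set P}
  {f : ℕ → P → ℝ} (hf : IsAdapted D ρ L U f)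

include hf

/-- dx, dy₀, …, dy₃ have the same common kernel as dx, θ₀, …, θ₃, which is zero. -/
theorem exists_chart (h : IsContactPathGeometry D ρ L) {q : P} (hq : q ∈ U) :
    ∃ φ ∈ IsManifold.maximalAtlas (𝓡 5) ∞ P, q ∈ φ.source ∧ φ.source ⊆ U ∧
      ∀ p ∈ φ.source, ∀ i : Fin 5, φ p i = f i p := by
  refine exists_chart_of_dFun (f := fun i : Fin 5 => f i) hf.isOpen (fun i => hf.smooth i) hq
    fun w hw => hf.eq_zero_of_apply_eq_zero h hq (hw 0) fun i hi => ?_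
  have h0 : dFun 5 (f 0) q w = 0 := hw 0
  have h1 : dFun 5 (f (i + 1)) q w = 0 := hw ⟨i + 1, by omega⟩
  change dFun 5 (f (i + 1)) q w - f (i + 2) q * dFun 5 (f 0) q w = 0
  rw [h1, h0, mul_zero, sub_zero]

/-- Along the jet of `y`, dx is 1 on the velocity and dyᵢ is the derivative of order i + 1, which is
yᵢ₊₁. So all four θᵢ vanish and the velocity is nonzero. -/
theorem isPathOn_of_isSolutionOn (h : IsContactPathGeometry D ρ L)
    {φ : OpenPartialHomeomorph P (EuclideanSpace ℝ (Fin 5))}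
    (hφ : φ ∈ IsManifold.maximalAtlas (𝓡 5) ∞ P) (hφU : φ.source ⊆ U)
    (hφf : ∀ p ∈ φ.source, ∀ i : Fin 5, φ p i = f i p) {y : ℝ → ℝ} {s : Set ℝ}
    (hy : IsSolutionOn (fun z => f 5 (φ.symm z)) φ.target y s) :
    IsPathOn L (fun t => φ.symm (jet y t)) s := by
  obtain ⟨hs, hs', hyd, hyj⟩ := hy
  have hjet : ContDiffOn ℝ ∞ (jet y) s := by
    rw [contDiffOn_euclidean]
    intro i
    fin_cases i
    exacts [contDiffOn_id, hyd, contDiffOn_iteratedDeriv hs hyd 1,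
      contDiffOn_iteratedDeriv hs hyd 2, contDiffOn_iteratedDeriv hs hyd 3]
  have hc : ContMDiffOn 𝓘(ℝ, ℝ) (𝓡 5) ∞ (fun t => φ.symm (jet y t)) s :=
    (contMDiffOn_symm_of_mem_maximalAtlas hφ).comp hjet.contMDiffOn fun t ht => (hyj t ht).1
  have hmem : ∀ t ∈ s, φ.symm (jet y t) ∈ φ.source := fun t ht => φ.map_target (hyj t ht).1
  have hcoord : ∀ t ∈ s, ∀ i : Fin 5, f i (φ.symm (jet y t)) = jet y t i := fun t ht i => by
    rw [← hφf _ (hmem t ht), φ.right_inv (hyj t ht).1]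
  -- For i ≤ 3 this reads off coordinates; the case i = 4 is the differential equation itself.
  have hderiv : ∀ i ≤ 4, ∀ t ∈ s, f (i + 1) (φ.symm (jet y t)) = iteratedDeriv i y t := by
    intro i hi t ht
    interval_cases i
    exacts [(hcoord t ht 1).trans (by rw [iteratedDeriv_zero]; rfl), hcoord t ht 2, hcoord t ht 3,
      hcoord t ht 4, (hyj t ht).2.symm]
  refine ⟨hs, hs', hc, fun t ht => ?_⟩
  have hvel : ∀ i, HasDerivAt (fun t => f i (φ.symm (jet y t))) _ t := fun i =>
    hasDerivAt_comp_curve hf.isOpen (hf.smooth i) hs hc ht (hφU (hmem t ht))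
  have hx := (hvel 0).unique ((hasDerivAt_id t).congr_of_eventuallyEq
    (Filter.eventuallyEq_of_mem (hs.mem_nhds ht) fun u hu => hcoord u hu 0))
  have hyi : ∀ i < 4, dFun 5 (f (i + 1)) (φ.symm (jet y t))
      (mfderiv 𝓘(ℝ, ℝ) (𝓡 5) (fun t => φ.symm (jet y t)) t (1 : ℝ)) =
        f (i + 2) (φ.symm (jet y t)) := by
    intro i hi
    rw [hderiv (i + 1) hi t ht, iteratedDeriv_succ]
    have h1 := ((contDiffOn_iteratedDeriv hs hyd i).contDiffAt (hs.mem_nhds ht)).differentiableAt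
      (by simp) |>.hasDerivAt
    exact (hvel (i + 1)).unique (h1.congr_of_eventuallyEq
      (Filter.eventuallyEq_of_mem (hs.mem_nhds ht) fun u hu => hderiv i hi.le u hu))
  constructor
  · intro h0
    rw [h0, map_zero] at hx
    exact zero_ne_one hx
  · refine (hf.mem_line_iff h (hφU (hmem t ht))).2 fun i hi => ?_
    rw [jetForm_apply, hyi i hi, hx, mul_one, sub_self]

/-- If dx vanished on the velocity, the whole coframe would, against immersion. So x can be inverted
along the path, and yᵢ' = yᵢ₊₁ x' makes yᵢ the i-th derivative of y₀ with respect to x; the fourth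
one is y₄ = F. -/
theorem exists_isSolutionOn_of_isPathOn (h : IsContactPathGeometry D ρ L)
    {φ : OpenPartialHomeomorph P (EuclideanSpace ℝ (Fin 5))} (hφU : φ.source ⊆ U)
    (hφf : ∀ p ∈ φ.source, ∀ i : Fin 5, φ p i = f i p) {γ : ℝ → P} {s : Set ℝ}
    (hγ : IsPathOn L γ s) (hγφ : ∀ t ∈ s, γ t ∈ φ.source) :
    Set.InjOn (fun t => φ (γ t) 0) s ∧ ∃ y : ℝ → ℝ,
      IsSolutionOn (fun z => f 5 (φ.symm z)) φ.target y ((fun t => φ (γ t) 0) '' s) ∧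
      ∀ t ∈ s, γ t = φ.symm (jet y (φ (γ t) 0)) := by
  obtain ⟨hs, hs', hγd, hγL⟩ := hγ
  have hvel : ∀ i, ∀ t ∈ s, HasDerivAt (fun t => f i (γ t)) _ t := fun i t ht =>
    hasDerivAt_comp_curve hf.isOpen (hf.smooth i) hs hγd ht (hφU (hγφ t ht))
  have hsm : ∀ i, ContDiffOn ℝ ∞ (fun t => f i (γ t)) s := fun i =>
    contMDiffOn_iff_contDiffOn.1 ((hf.smooth i).comp hγd fun t ht => hφU (hγφ t ht))
  have hY : ∀ k, ∀ t ∈ s, HasDerivAt (fun t => f (k + 1) (γ t))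
      (f (k + 2) (γ t) * deriv (fun t => f 0 (γ t)) t) t := by
    intro k t ht
    obtain ⟨v, hv, -, hvj⟩ := hf.exists_line (hφU (hγφ t ht))
    have h1 := (hγL t ht).2
    rw [hv] at h1
    obtain ⟨c, hc⟩ := Submodule.mem_span_singleton.1 h1
    have h2 : jetForm f k (γ t) (mfderiv 𝓘(ℝ, ℝ) (𝓡 5) γ t (1 : ℝ)) = 0 := by
      rw [← hc, map_smul, hvj, smul_zero]
    rw [jetForm_apply, sub_eq_zero] at h2
    rw [(hvel 0 t ht).deriv, ← h2]
    exact hvel (k + 1) t ht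
  have hx' : ∀ t ∈ s, deriv (fun t => f 0 (γ t)) t ≠ 0 := by
    intro t ht h0
    rw [(hvel 0 t ht).deriv] at h0
    exact (hγL t ht).1 (hf.eq_zero_of_apply_eq_zero h (hφU (hγφ t ht)) h0
      ((hf.mem_line_iff h (hφU (hγφ t ht))).1 (hγL t ht).2))
  have hx : s.EqOn (fun t => φ (γ t) 0) (fun t => f 0 (γ t)) := fun t ht => hφf _ (hγφ t ht) 0
  obtain ⟨himo, himc, τ, hτ, hτx⟩ := exists_smooth_inverse hs hs' (hsm 0) hx'
  have hiter := iteratedDeriv_comp_inverse (Y := fun k t => f (k + 1) (γ t)) hs himo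
    (fun t ht => (hvel 0 t ht).differentiableAt) hY
    (fun z hz => (hτ.contDiffAt (himo.mem_nhds hz)).differentiableAt (by simp)) hτx
  have hjet : ∀ t ∈ s, jet ((fun t => f 1 (γ t)) ∘ τ) (f 0 (γ t)) = φ (γ t) := by
    intro t ht
    ext i
    rw [hφf _ (hγφ t ht)]
    fin_cases i
    exacts [rfl, (by rw [← iteratedDeriv_zero (f := (fun t => f 1 (γ t)) ∘ τ)]; exact hiter 0 t ht),
      hiter 1 t ht, hiter 2 t ht, hiter 3 t ht]
  rw [hx.image_eq]
  refine ⟨(injOn_of_deriv_ne_zero hs' (hsm 0).continuousOn hx').congr hx.symm,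
    (fun t => f 1 (γ t)) ∘ τ, ⟨himo, himc, (hsm 1).comp hτ ?_, ?_⟩, fun t ht => ?_⟩
  · rintro _ ⟨t, ht, rfl⟩
    exact (hτx t ht).symm ▸ ht
  · rintro _ ⟨t, ht, rfl⟩
    simp only [hjet t ht]
    exact ⟨φ.map_source (hγφ t ht), by rw [φ.left_inv (hγφ t ht)]; exact hiter 4 t ht⟩
  · rw [hφf _ (hγφ t ht) 0]
    refine ((congrArg φ.symm (hjet t ht)).trans (φ.left_inv (hγφ t ht))).symm

theorem isZeroAdapted_chart (h : IsContactPathGeometry D ρ L)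
    {φ : OpenPartialHomeomorph P (EuclideanSpace ℝ (Fin 5))} (hφU : φ.source ⊆ U)
    (hφf : ∀ p ∈ φ.source, ∀ i : Fin 5, φ p i = f i p) :
    IsZeroAdapted D ρ L φ.source (fun p => -dFun 5 (fun p => φ p 0) p)
      ![fun p => dFun 5 (fun p => φ p 1) p - φ p 2 • dFun 5 (fun p => φ p 0) p,
        fun p => dFun 5 (fun p => φ p 2) p - φ p 3 • dFun 5 (fun p => φ p 0) p,
        fun p => dFun 5 (fun p => φ p 3) p - φ p 4 • dFun 5 (fun p => φ p 0) p,
        fun p => dFun 5 (fun p => φ p 4) p -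
          f 5 (φ.symm (φ p)) • dFun 5 (fun p => φ p 0) p] := by
  have hd : ∀ i : Fin 5, ∀ p ∈ φ.source, dFun 5 (fun p => φ p i) p = dFun 5 (f i) p :=
    fun i p hp => dFun_congr φ.open_source (fun p hp => hφf p hp i) hp
  refine (hf.isZeroAdapted h).congr φ.open_source hφU
    (fun p hp => congrArg Neg.neg (hd 0 p hp)) fun i p hp => ?_
  fin_cases i
  · change dFun 5 (fun p => φ p 1) p - φ p 2 • dFun 5 (fun p => φ p 0) p = _
    rw [hd 0 p hp, hd 1 p hp, hφf p hp 2]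
    rfl
  · change dFun 5 (fun p => φ p 2) p - φ p 3 • dFun 5 (fun p => φ p 0) p = _
    rw [hd 0 p hp, hd 2 p hp, hφf p hp 3]
    rfl
  · change dFun 5 (fun p => φ p 3) p - φ p 4 • dFun 5 (fun p => φ p 0) p = _
    rw [hd 0 p hp, hd 3 p hp, hφf p hp 4]
    rfl
  · change dFun 5 (fun p => φ p 4) p - f 5 (φ.symm (φ p)) • dFun 5 (fun p => φ p 0) p = _
    rw [hd 0 p hp, hd 4 p hp, φ.left_inv hp]
    rfl

end IsAdapted

end Adapted

end ContactPath

end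

theorem mainTheorem5 {P M : Type*}
    [TopologicalSpace P] [ChartedSpace (EuclideanSpace ℝ (Fin 5)) P] [IsManifold (𝓡 5) ∞ P]
    [TopologicalSpace M] [ChartedSpace (EuclideanSpace ℝ (Fin 3)) M] [IsManifold (𝓡 3) ∞ M]
    (D : ContactPath.TangentSubspaces 3 M) (ρ : P → M) (L : ContactPath.TangentSubspaces 5 P)
    (h : ContactPath.IsContactPathGeometry D ρ L) (q : P) :
    ∃ φ ∈ IsManifold.maximalAtlas (𝓡 5) ∞ P, q ∈ φ.source ∧
      ∃ F : EuclideanSpace ℝ (Fin 5) → ℝ, ContDiffOn ℝ ∞ F φ.target ∧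
        -- the coordinates `x = φ 0`, `y i = φ (i + 1)` give a 0-adapted coframe
        ContactPath.IsZeroAdapted D ρ L φ.source
          (fun p => -ContactPath.dFun 5 (fun p => φ p 0) p)
          ![fun p => ContactPath.dFun 5 (fun p => φ p 1) p
              - φ p 2 • ContactPath.dFun 5 (fun p => φ p 0) p,
            fun p => ContactPath.dFun 5 (fun p => φ p 2) p
              - φ p 3 • ContactPath.dFun 5 (fun p => φ p 0) p,
            fun p => ContactPath.dFun 5 (fun p => φ p 3) p
              - φ p 4 • ContactPath.dFun 5 (fun p => φ p 0) p,
            fun p => ContactPath.dFun 5 (fun p => φ p 4) p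
              - F (φ p) • ContactPath.dFun 5 (fun p => φ p 0) p] ∧
        -- every solution gives a path in the domain of the coordinates
        (∀ (y : ℝ → ℝ) (s : Set ℝ), ContactPath.IsSolutionOn F φ.target y s →
          ContactPath.IsPathOn L (fun t => φ.symm (ContactPath.jet y t)) s) ∧
        -- every path in this domain is, up to parametrisation by `x`, given by a solution
        (∀ (γ : ℝ → P) (s : Set ℝ), ContactPath.IsPathOn L γ s → (∀ t ∈ s, γ t ∈ φ.source) →
          Set.InjOn (fun t => φ (γ t) 0) s ∧
          ∃ y : ℝ → ℝ,
            ContactPath.IsSolutionOn F φ.target y ((fun t => φ (γ t) 0) '' s) ∧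
            ∀ t ∈ s, γ t = φ.symm (ContactPath.jet y (φ (γ t) 0))) := by
  obtain ⟨U, f, hq, hf⟩ := h.exists_isAdapted q
  obtain ⟨φ, hφ, hqφ, hφU, hφf⟩ := hf.exists_chart h hq
  -- The sequence begins with x, so `f 5` is y₄, the derivative of y₃ along L with respect to x.
  refine ⟨φ, hφ, hqφ, fun z => f 5 (φ.symm z), ?_, hf.isZeroAdapted_chart h hφU hφf,
    fun y s hy => hf.isPathOn_of_isSolutionOn h hφ hφU hφf hy,
    fun γ s hγ hγφ => hf.exists_isSolutionOn_of_isPathOn h hφU hφf hγ hγφ⟩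
  exact contMDiffOn_iff_contDiffOn.1 ((hf.smooth 5).comp
    (contMDiffOn_symm_of_mem_maximalAtlas hφ) fun z hz => hφU (φ.map_target hz))
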